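/- **Setting.** Let $G=(V,E)$ be a finite simple graph. For each $i\in V$ let $y_i$ be a discrete variable with values in a finite non-empty set $\mathcal X_i$. For a configuration $\mathbf y=(y_i)_{i\in V}$ let $S(\mathbf y)$ be the 0-1 vector with one coordinate for each state of each node and one for each joint setting of the two endpoints of each edge, equal to $1$ exactly when $\mathbf y$ takes that state or setting. The marginal polytope is $\mathcal M=\{\mathbb E_P[S(\mathbf y)] : P \text{ a probability distribution on configurations}\}$. Its elements $\mu$ are vectors of node marginals $\mu_i$ and edge marginals $\mu_e$. The Bethe entropy is $$H_{\mathcal B}(\mu)=\sum_{e\in E}H(\mu_e)-\sum_{i\in V}(d_i-1)\,H(\mu_i),$$ where $d_i$ is the degree of $i$ and $H(p)=-\sum_a p_a\ln p_a$. For a parameter vector $\theta$, $\text{MARGINAL-ORACLE}(\theta)$ returns a minimizer over $\mathcal M$ of $-H_{\mathcal B}(\mu)-\langle\theta,\mu\rangle$. For an energy function $L$, the augmented objective is $$F(\mu)=-H_{\mathcal B}(\mu)-\langle\theta,\mu\rangle+L(\mu).$$ **Algorithm (Bethe-RDA).** The input is $\theta$, $L$ and a constant $\beta\ge 0$. Set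 $\bar g_0=0$ and $\mu_0=\text{MARGINAL-ORACLE}(\theta)$. For $t=1,2,\dots$ set $$\bar g_t=\tfrac{t-1}{t}\,\bar g_{t-1}+\tfrac1t\nabla L(\mu_{t-1}),\qquad \theta_t=\theta-\tfrac{t}{t+\beta}\,\bar g_t,\qquad \mu_t=\text{MARGINAL-ORACLE}(\theta_t).$$ The primal averages are $\bar\mu_t=\frac1t\sum_{k=0}^{t-1}\mu_k$ for $t\ge 1$. **Proposition.** Suppose that $-H_{\mathcal B}$ is convex on $\mathcal M$, and that $L$ is a real-valued, convex and differentiable function on a convex open set $U\supseteq\mathcal M$. Let $\theta$ be any parameter vector and $\beta\ge0$. Then $F$ has a unique minimizer $\mu^*$ over $\mathcal M$, the primal averages satisfy $\bar\mu_t\to\mu^*$, and $$F(\bar\mu_t)-F(\mu^*)=O\!\left(\frac{\ln t}{t}\right)\qquad (t\to\infty).$$ -/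

import Mathlib

open Filter Topology Asymptotics

noncomputable section

namespace BetheRDA

universe u w

/-- The joint settings `(y_i, y_j)` of the two endpoints of an edge `e = {i, j}`. -/
abbrev EdgeSetting {V : Type u} (G : SimpleGraph V) (X : V → Type w) (e : G.edgeSet) :
    Type (max u w) :=
  (v : {v : V // v ∈ (e : Sym2 V)}) → X v

/-- Coordinates of a vector of node and edge marginals: one for each state of each node
and one for each joint setting of each edge. -/
abbrev Stat {V : Type u} (G : SimpleGraph V) (X : V → Type w) : Type (max u w) :=
  (Σ i : V, X i) ⊕ (Σ e : G.edgeSet, EdgeSetting G X e)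

/-- The Euclidean space of concatenated vectors of node and edge marginals. -/
abbrev MarginalVec {V : Type u} (G : SimpleGraph V) (X : V → Type w) : Type (max u w) :=
  EuclideanSpace ℝ (Stat G X)

section Model

variable {V : Type u} [Fintype V] [DecidableEq V] (G : SimpleGraph V) [DecidableRel G.Adj]
  (X : V → Type w) [∀ i, Fintype (X i)] [∀ i, DecidableEq (X i)]

/-- The 0-1 vector `S(y)` of sufficient statistics of a configuration `y`. -/
def suffStat (y : ∀ i, X i) : MarginalVec G X :=
  WithLp.toLp 2 (Sum.elim
    (fun p : (Σ i : V, X i) => if y p.1 = p.2 then (1 : ℝ) else 0)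
    (fun p : (Σ e : G.edgeSet, EdgeSetting G X e) =>
      if (fun v : {v : V // v ∈ (p.1 : Sym2 V)} => y v) = p.2 then (1 : ℝ) else 0))

/-- The marginal polytope `M`: the vectors `E_P[S(y)]`, where `P` ranges over the probability
distributions on configurations. -/
def marginalPolytope : Set (MarginalVec G X) :=
  {m | ∃ p ∈ stdSimplex ℝ (∀ i, X i), m = ∑ y, p y • suffStat G X y}

/-- The Bethe entropy `∑_e H(μ_e) - ∑_i (deg i - 1) H(μ_i)`. -/
def betheEntropy (m : MarginalVec G X) : ℝ :=
  (∑ e : G.edgeSet, ∑ z : EdgeSetting G X e, Real.negMulLog (m (Sum.inr ⟨e, z⟩)))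
    - ∑ i : V, ((G.degree i : ℝ) - 1) * ∑ x : X i, Real.negMulLog (m (Sum.inl ⟨i, x⟩))

/-- The objective `-H_B(μ) - ⟨θ, μ⟩` of marginal inference. -/
def inferenceObjective (θ m : MarginalVec G X) : ℝ :=
  -betheEntropy G X m - inner ℝ θ m

/-- The augmented objective `-H_B(μ) - ⟨θ, μ⟩ + L(μ)`. -/
def augmentedObjective (θ : MarginalVec G X) (L : MarginalVec G X → ℝ)
    (m : MarginalVec G X) : ℝ :=
  -betheEntropy G X m - inner ℝ θ m + L m

theorem isCompact_marginalPolytope : IsCompact (marginalPolytope G X) := by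
  have h : marginalPolytope G X =
      (fun p : (∀ i, X i) → ℝ => ∑ y, p y • suffStat G X y) '' stdSimplex ℝ (∀ i, X i) := by
    ext m
    constructor
    · rintro ⟨p, hp, rfl⟩
      exact ⟨p, hp, rfl⟩
    · rintro ⟨p, hp, rfl⟩
      exact ⟨p, hp, rfl⟩
  rw [h]
  exact (isCompact_stdSimplex ℝ _).image (by fun_prop)

theorem marginalPolytope_nonempty [∀ i, Nonempty (X i)] : (marginalPolytope G X).Nonempty :=
  ⟨_, Pi.single (Classical.arbitrary _) 1, single_mem_stdSimplex ℝ _, rfl⟩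

theorem continuous_betheEntropy : Continuous (betheEntropy G X) := by
  unfold betheEntropy
  refine Continuous.sub ?_ ?_
  · exact continuous_finsetSum _ fun e _ => continuous_finsetSum _ fun z _ =>
      Real.continuous_negMulLog.comp (by fun_prop)
  · exact continuous_finsetSum _ fun i _ => continuous_const.mul
      (continuous_finsetSum _ fun x _ => Real.continuous_negMulLog.comp (by fun_prop))

theorem exists_isMinOn_inferenceObjective [∀ i, Nonempty (X i)] (θ : MarginalVec G X) :
    ∃ m, m ∈ marginalPolytope G X ∧
      IsMinOn (inferenceObjective G X θ) (marginalPolytope G X) m := by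
  have hc : Continuous (inferenceObjective G X θ) := by
    unfold inferenceObjective
    exact (continuous_betheEntropy G X).neg.sub (by fun_prop)
  exact (isCompact_marginalPolytope G X).exists_isMinOn (marginalPolytope_nonempty G X)
    hc.continuousOn

variable [∀ i, Nonempty (X i)]

/-- `MARGINAL-ORACLE(θ)`: a minimizer of `-H_B(μ) - ⟨θ, μ⟩` over the marginal polytope. -/
def marginalOracle (θ : MarginalVec G X) : MarginalVec G X :=
  Classical.choose (exists_isMinOn_inferenceObjective G X θ)

/-- The state `(ḡ_t, μ_t)` of Bethe-RDA with parameters `θ`, energy `L` and constant `β`: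
`ḡ_0 = 0`, `μ_0 = ORACLE(θ)` and, for `t ≥ 1`,
`ḡ_t = ((t-1)/t) ḡ_{t-1} + (1/t) ∇L(μ_{t-1})`, `θ_t = θ - (t/(t+β)) ḡ_t`, `μ_t = ORACLE(θ_t)`. -/
def betheRDA (θ : MarginalVec G X) (L : MarginalVec G X → ℝ) (β : ℝ) :
    ℕ → MarginalVec G X × MarginalVec G X
  | 0 => (0, marginalOracle G X θ)
  | t + 1 =>
    let s : ℝ := (t : ℝ) + 1
    let g := ((s - 1) / s) • (betheRDA θ L β t).1
      + (1 / s) • gradient L (betheRDA θ L β t).2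
    (g, marginalOracle G X (θ - (s / (s + β)) • g))

/-- The primal average `(μ_0 + ⋯ + μ_{t-1}) / t` of the first `t` iterates. -/
def primalAverage (θ : MarginalVec G X) (L : MarginalVec G X → ℝ) (β : ℝ) (t : ℕ) :
    MarginalVec G X :=
  (1 / (t : ℝ)) • ∑ k ∈ Finset.range t, (betheRDA G X θ L β k).2

end Model

end BetheRDA

end

set_option linter.unusedSectionVars false

noncomputable section

namespace BetheRDA

universe u w

section Model

variable {V : Type u} [Fintype V] [DecidableEq V] (G : SimpleGraph V) [DecidableRel G.Adj]
  (X : V → Type w) [∀ i, Fintype (X i)] [∀ i, DecidableEq (X i)]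

/-! ### Orientations of the edges -/

/-! Convexity of `-H_B` on the polytope already forces uniform strong convexity wherever the
marginals are bounded below. All iterates and the minimizer live in such a region, so the
logarithmic regret of dual averaging applies.

The core is combinatorial. Let `y` and `y'` differ exactly on a set `W` of nodes with several
states. `H_B` vanishes at `S(y)` and `S(y')`, so by convexity it is non-negative at their midpoint,
where it is `log 2` times a count of edges and degrees. This says that `W` spans at most `|W|`
edges, which is Hall's condition for giving each edge a head of its own (`exists_orientation`). For
such an orientation, `∑_e A_e - ∑_i (d_i - 1) g_i = ∑_e (A_e - g_{t(e)}) + ∑_i (1 - indeg i) g_i`,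
and each term is non-negative once `g_{t(e)} ≤ A_e` and `g` is non-negative and vanishes at
one-state nodes.

This identity is used twice. With the second-order terms it makes the Hessian of `-H_B` positive
definite at positive marginals (`hessian_pos`). With the masses of the vanishing coordinates
(`sum_weight_zero_pos`) it shows that `-H_B` has slope `-∞` from a point with a zero marginal
towards a positive point, so no minimizer has a zero marginal (`pos_of_isMinOn`).

Gradients of `L` are bounded on the polytope, hence the `θ_t` are bounded, and by compactness all
iterates have marginals at least some `ε > 0`. There the Hessian bound gives quadratic growth and
`dualAveraging_regret` gives regret `O(log t)`. Linearizing `L` and Jensen's inequality turn the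
regret into the rate for the averages; quadratic growth at the minimizer turns the rate into
convergence. -/

theorem sum_degree_mul (g : V → ℝ) :
    ∑ i, (G.degree i : ℝ) * g i
      = ∑ e : G.edgeSet, ∑ i, if i ∈ (e : Sym2 V) then g i else 0 := by
  rw [Finset.sum_comm]
  refine Finset.sum_congr rfl fun i _ => ?_
  have h : (G.degree i : ℝ) = ∑ e : G.edgeSet, if i ∈ (e : Sym2 V) then (1 : ℝ) else 0 := by
    rw [← G.card_incidenceFinset_eq_degree, G.incidenceFinset_eq_filter, Finset.card_filter]
    push_cast
    exact Finset.sum_subtype G.edgeFinset (fun e => G.mem_edgeFinset)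
      (fun e => if i ∈ e then (1 : ℝ) else 0)
  rw [h, Finset.sum_mul]
  refine Finset.sum_congr rfl fun e _ => ?_
  split_ifs <;> simp

/-- Two distinct point masses average to a fair coin, of entropy `log 2`; two equal ones average to
a point mass, of entropy zero. -/
theorem sum_negMulLog_midpoint {α : Type*} [Fintype α] [DecidableEq α] (a b : α) :
    ∑ x, Real.negMulLog ((1 / 2 : ℝ) * (if a = x then 1 else 0)
      + (1 / 2 : ℝ) * (if b = x then 1 else 0)) = if a = b then 0 else Real.log 2 := by
  split_ifs with h
  · subst h
    refine Finset.sum_eq_zero fun x _ => ?_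
    split_ifs <;> norm_num
  · have hhalf : Real.negMulLog (1 / 2) = Real.log 2 / 2 := by
      rw [Real.negMulLog, one_div, Real.log_inv]; ring
    have : ∀ x, Real.negMulLog ((1 / 2 : ℝ) * (if a = x then 1 else 0)
        + (1 / 2 : ℝ) * (if b = x then 1 else 0))
        = (if a = x then Real.log 2 / 2 else 0) + (if b = x then Real.log 2 / 2 else 0) := by
      intro x
      by_cases h1 : a = x
      · have h2 : b ≠ x := fun h2 => h (h1.trans h2.symm)
        simp only [h1, h2, if_true, if_false, mul_one, mul_zero, add_zero, hhalf]
      · by_cases h2 : b = x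
        · simp only [h1, h2, if_true, if_false, mul_one, mul_zero, zero_add, hhalf]
        · simp [h1, h2]
    simp only [this, Finset.sum_add_distrib, Finset.sum_ite_eq, Finset.mem_univ, if_true]
    ring

theorem sum_negMulLog_indicator {α : Type*} [Fintype α] [DecidableEq α] (a : α) :
    ∑ x, Real.negMulLog (if a = x then (1 : ℝ) else 0) = 0 :=
  Finset.sum_eq_zero fun x _ => by split_ifs <;> simp

theorem suffStat_mem_marginalPolytope (y : ∀ i, X i) :
    suffStat G X y ∈ marginalPolytope G X := by
  classical
  refine ⟨Pi.single y 1, single_mem_stdSimplex ℝ _, ?_⟩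
  rw [Finset.sum_eq_single y]
  · simp
  · intro z _ hz
    simp [Pi.single_eq_of_ne hz]
  · simp

theorem betheEntropy_suffStat (y : ∀ i, X i) : betheEntropy G X (suffStat G X y) = 0 := by
  unfold betheEntropy suffStat
  simp only [Sum.elim_inl, Sum.elim_inr]
  have h1 : ∀ e : G.edgeSet, ∑ z : EdgeSetting G X e, Real.negMulLog
      (if (fun v : {v : V // v ∈ (e : Sym2 V)} => y v) = z then (1 : ℝ) else 0) = 0 :=
    fun e => sum_negMulLog_indicator _
  have h2 : ∀ i : V, ∑ x : X i, Real.negMulLog (if y i = x then (1 : ℝ) else 0) = 0 :=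
    fun i => sum_negMulLog_indicator _
  simp only [h1, h2]
  simp

/-- Each marginal of the midpoint is a point mass or a fair coin, so the Bethe entropy only counts
the nodes where `y` and `y'` differ and the edges touching such a node. -/
theorem betheEntropy_midpoint (y y' : ∀ i, X i) :
    betheEntropy G X ((1 / 2 : ℝ) • suffStat G X y + (1 / 2 : ℝ) • suffStat G X y')
      = ((∑ e : G.edgeSet, if ∃ i ∈ (e : Sym2 V), y i ≠ y' i then (1 : ℝ) else 0)
        - ∑ i, ((G.degree i : ℝ) - 1) * if y i ≠ y' i then 1 else 0) * Real.log 2 := by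
  classical
  unfold betheEntropy suffStat
  simp only [PiLp.add_apply, PiLp.smul_apply, smul_eq_mul, Sum.elim_inl, Sum.elim_inr]
  have h1 : ∀ e : G.edgeSet, ∑ z : EdgeSetting G X e, Real.negMulLog ((1 / 2 : ℝ) *
      (if (fun v : {v : V // v ∈ (e : Sym2 V)} => y v) = z then (1 : ℝ) else 0) + (1 / 2 : ℝ) *
      (if (fun v : {v : V // v ∈ (e : Sym2 V)} => y' v) = z then (1 : ℝ) else 0))
      = (if ∃ i ∈ (e : Sym2 V), y i ≠ y' i then (1 : ℝ) else 0) * Real.log 2 := by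
    intro e
    rw [sum_negMulLog_midpoint]
    by_cases h : ∃ i ∈ (e : Sym2 V), y i ≠ y' i
    · rw [if_neg, if_pos h, one_mul]
      intro h'
      obtain ⟨i, hi, hne⟩ := h
      exact hne (congrFun h' ⟨i, hi⟩)
    · rw [if_pos, if_neg h, zero_mul]
      push Not at h
      funext v
      exact h v v.2
  have h2 : ∀ i : V, ∑ x : X i, Real.negMulLog ((1 / 2 : ℝ) * (if y i = x then (1 : ℝ) else 0)
      + (1 / 2 : ℝ) * (if y' i = x then (1 : ℝ) else 0))
      = (if y i ≠ y' i then 1 else 0) * Real.log 2 := by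
    intro i
    rw [sum_negMulLog_midpoint]
    split_ifs <;> simp_all
  simp only [h1, h2, sub_mul, Finset.sum_mul, mul_assoc]

/-- Convexity of `-H_B` bounds the number of edges spanned by nodes with several states. -/
theorem sum_edge_le_of_convexOn [∀ i, Nonempty (X i)]
    (hH : ConvexOn ℝ (marginalPolytope G X) (fun m => -betheEntropy G X m))
    (W : Finset V) (hW : ∀ i ∈ W, Nontrivial (X i)) :
    ∑ e : G.edgeSet, ((∑ i, if i ∈ (e : Sym2 V) then (if i ∈ W then (1 : ℝ) else 0) else 0)
      - if ∃ i ∈ (e : Sym2 V), i ∈ W then 1 else 0) ≤ W.card := by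
  classical
  -- The two components of `p` form configurations that differ exactly on `W`.
  have hex : ∀ i, ∃ p : X i × X i, p.1 ≠ p.2 ↔ i ∈ W := by
    intro i
    by_cases hi : i ∈ W
    · obtain ⟨a, b, hab⟩ := (hW i hi).exists_pair_ne
      exact ⟨(a, b), by simp [hab, hi]⟩
    · exact ⟨(Classical.arbitrary _, Classical.arbitrary _), by simp [hi]⟩
  choose p hp using hex
  have hc := hH.2 (suffStat_mem_marginalPolytope G X fun i => (p i).1)
    (suffStat_mem_marginalPolytope G X fun i => (p i).2)
    (by norm_num : (0 : ℝ) ≤ 1 / 2) (by norm_num : (0 : ℝ) ≤ 1 / 2) (by norm_num)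
  simp only [betheEntropy_midpoint, betheEntropy_suffStat, hp] at hc
  have hpos : 0 ≤ (∑ e : G.edgeSet, if ∃ i ∈ (e : Sym2 V), i ∈ W then (1 : ℝ) else 0)
        - ∑ i, ((G.degree i : ℝ) - 1) * if i ∈ W then 1 else 0 := by
    refine nonneg_of_mul_nonneg_left ?_ (Real.log_pos one_lt_two)
    simpa using hc
  have hd := sum_degree_mul G (fun i => if i ∈ W then (1 : ℝ) else 0)
  have hcard : ∑ i, (if i ∈ W then (1 : ℝ) else 0) = W.card := by simp
  simp only [sub_mul, one_mul, Finset.sum_sub_distrib, hd, hcard] at hpos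
  rw [Finset.sum_sub_distrib]
  linarith

/-- The edges can be oriented, from `t e` to `h e`, in such a way that every node with several
states is the head of at most one edge. -/
theorem exists_orientation [∀ i, Nonempty (X i)]
    (hH : ConvexOn ℝ (marginalPolytope G X) (fun m => -betheEntropy G X m)) :
    ∃ t h : G.edgeSet → V, (∀ e, t e ≠ h e) ∧ (∀ e : G.edgeSet, (e : Sym2 V) = s(t e, h e)) ∧
      ∀ e e', h e = h e' → Nontrivial (X (h e)) → e = e' := by
  classical
  -- Only these edges need distinct heads; any other edge is directed at an endpoint with a single
  -- state, where the indegree is unrestricted.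
  let E' := {e : G.edgeSet // ∀ i ∈ (e : Sym2 V), Nontrivial (X i)}
  let ends : E' → Finset V := fun e => Finset.univ.filter fun i => i ∈ ((e : G.edgeSet) : Sym2 V)
  -- Hall's condition: with `W` the endpoints of `s`, each edge of `s` contributes `2 - 1` to the
  -- sum bounded by `|W|`, and the other edges contribute at least `0`.
  have hall : ∀ s : Finset E', s.card ≤ (s.biUnion ends).card := by
    intro s
    set W := s.biUnion ends with hWdef
    have hW : ∀ i ∈ W, Nontrivial (X i) := by
      intro i hi
      obtain ⟨e, _, hie⟩ := Finset.mem_biUnion.1 hi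
      exact e.2 i (Finset.mem_filter.1 hie).2
    have key := sum_edge_le_of_convexOn G X hH W hW
    have hle : ∑ e : G.edgeSet, (if e ∈ s.map (Function.Embedding.subtype _) then (1 : ℝ) else 0)
        ≤ W.card := by
      refine le_trans (Finset.sum_le_sum fun e _ => ?_) key
      obtain ⟨⟨a, b⟩, he⟩ := e
      have hab : a ≠ b := G.ne_of_adj he
      have hsum : (∑ i, if i ∈ s(a, b) then (if i ∈ W then (1 : ℝ) else 0) else 0)
          = (if a ∈ W then 1 else 0) + if b ∈ W then 1 else 0 := by
        have : ∀ i, (if i ∈ s(a, b) then (if i ∈ W then (1 : ℝ) else 0) else 0)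
            = (if a = i then (if a ∈ W then 1 else 0) else 0)
              + if b = i then (if b ∈ W then 1 else 0) else 0 := by
          intro i
          by_cases h1 : a = i
          · subst h1; simp [hab.symm]
          · by_cases h2 : b = i
            · subst h2; simp [hab]
            · simp [Ne.symm h1, Ne.symm h2, h1, h2]
        simp only [this, Finset.sum_add_distrib, Finset.sum_ite_eq, Finset.mem_univ, if_true]
      change (if _ then (1 : ℝ) else 0) ≤ (∑ i, if i ∈ s(a, b) then _ else 0)
        - if ∃ i ∈ s(a, b), i ∈ W then 1 else 0
      rw [hsum]
      by_cases hs : (⟨s(a, b), he⟩ : G.edgeSet) ∈ s.map (Function.Embedding.subtype _)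
      · obtain ⟨e', he', hee⟩ := Finset.mem_map.1 hs
        have hm : ∀ i ∈ s(a, b), i ∈ W := by
          intro i hi
          refine Finset.mem_biUnion.2 ⟨e', he', Finset.mem_filter.2 ⟨Finset.mem_univ _, ?_⟩⟩
          have : (e' : G.edgeSet) = ⟨s(a, b), he⟩ := hee
          rw [this]
          exact hi
        have ha := hm a (Sym2.mem_mk_left a b)
        have hb := hm b (Sym2.mem_mk_right a b)
        rw [if_pos hs, if_pos ha, if_pos hb]
        split_ifs <;> norm_num
      · rw [if_neg hs]
        by_cases ha : a ∈ W <;> by_cases hb : b ∈ W <;> simp [ha, hb]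
    have hcard : ∑ e : G.edgeSet,
        (if e ∈ s.map (Function.Embedding.subtype _) then (1 : ℝ) else 0) = s.card := by
      rw [Finset.sum_boole, Finset.filter_univ_mem, Finset.card_map]
    rw [hcard] at hle
    exact_mod_cast hle
  obtain ⟨f, hf, hfm⟩ := (Finset.all_card_le_biUnion_card_iff_exists_injective ends).1 hall
  have hh : ∀ e : G.edgeSet, ∃ v ∈ (e : Sym2 V),
      if he : ∀ i ∈ (e : Sym2 V), Nontrivial (X i) then v = f ⟨e, he⟩ else ¬ Nontrivial (X v) := by
    intro e
    by_cases he : ∀ i ∈ (e : Sym2 V), Nontrivial (X i)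
    · exact ⟨f ⟨e, he⟩, (Finset.mem_filter.1 (hfm ⟨e, he⟩)).2, by rw [dif_pos he]⟩
    · simp only [dif_neg he]
      push Not at he
      obtain ⟨i, hi, hn⟩ := he
      exact ⟨i, hi, by rwa [not_nontrivial_iff_subsingleton]⟩
  choose h hmem hspec using hh
  refine ⟨fun e => Sym2.Mem.other (hmem e), h, fun e => ?_, fun e => ?_, fun e e' hee hn => ?_⟩
  · exact Sym2.other_ne (G.not_isDiag_of_mem_edgeSet e.2) (hmem e)
  · rw [Sym2.eq_swap]
    exact (Sym2.other_spec (hmem e)).symm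
  · have h1 := hspec e
    have h2 := hspec e'
    split_ifs at h1 with c1
    · split_ifs at h2 with c2
      · have := hf (h1.symm.trans (hee.trans h2))
        exact congrArg Subtype.val this
      · exact absurd (hee ▸ hn) h2
    · exact absurd hn h1

variable {G X} in
/-- Orienting the edges writes `∑_e A_e - ∑_i (d_i - 1) g_i` as a sum of non-negative terms. -/
theorem orientation_sum_nonneg {t h : G.edgeSet → V} (hth : ∀ e, t e ≠ h e)
    (hedge : ∀ e : G.edgeSet, (e : Sym2 V) = s(t e, h e))
    (hhead : ∀ e e', h e = h e' → Nontrivial (X (h e)) → e = e')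
    (A : G.edgeSet → ℝ) (g : V → ℝ) (hA : ∀ e, g (t e) ≤ A e) (hg : ∀ i, 0 ≤ g i)
    (hg0 : ∀ i, ¬ Nontrivial (X i) → g i = 0) :
    0 ≤ ∑ e, A e - ∑ i, ((G.degree i : ℝ) - 1) * g i ∧
    (∑ e, A e - ∑ i, ((G.degree i : ℝ) - 1) * g i ≤ 0 →
      (∀ e, A e = g (t e)) ∧ ∀ i, g i ≠ 0 → ∃ e, h e = i) := by
  classical
  have hdeg : ∑ i, (G.degree i : ℝ) * g i = ∑ e, g (t e) + ∑ e, g (h e) := by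
    rw [sum_degree_mul, ← Finset.sum_add_distrib]
    refine Finset.sum_congr rfl fun e _ => ?_
    rw [hedge e]
    have : ∀ i, (if i ∈ s(t e, h e) then g i else 0)
        = (if t e = i then g (t e) else 0) + if h e = i then g (h e) else 0 := by
      intro i
      by_cases h1 : t e = i
      · subst h1; simp [(hth e).symm]
      · by_cases h2 : h e = i
        · subst h2; simp [hth e]
        · simp [Ne.symm h1, Ne.symm h2, h1, h2]
    simp only [this, Finset.sum_add_distrib, Finset.sum_ite_eq, Finset.mem_univ, if_true]
  have hin : ∑ e, g (h e) = ∑ i, ((Finset.univ.filter fun e => h e = i).card : ℝ) * g i := by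
    rw [← Finset.sum_fiberwise Finset.univ h]
    refine Finset.sum_congr rfl fun i _ => ?_
    rw [Finset.sum_congr rfl (g := fun _ => g i) fun e he => by rw [(Finset.mem_filter.1 he).2]]
    simp
  -- The degree splits into outdegree and indegree: the outgoing part is charged to the edges, the
  -- incoming part to the nodes.
  have hdec : ∑ e, A e - ∑ i, ((G.degree i : ℝ) - 1) * g i = ∑ e, (A e - g (t e))
      + ∑ i, (1 - ((Finset.univ.filter fun e => h e = i).card : ℝ)) * g i := by
    simp only [sub_mul, one_mul, Finset.sum_sub_distrib, hdeg, hin]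
    ring
  have h1 : ∀ e ∈ (Finset.univ : Finset G.edgeSet), 0 ≤ A e - g (t e) :=
    fun e _ => sub_nonneg.2 (hA e)
  have h2 : ∀ i ∈ (Finset.univ : Finset V),
      0 ≤ (1 - ((Finset.univ.filter fun e => h e = i).card : ℝ)) * g i := by
    intro i _
    by_cases hi : Nontrivial (X i)
    · refine mul_nonneg (sub_nonneg.2 ?_) (hg i)
      have : (Finset.univ.filter fun e => h e = i).card ≤ 1 := by
        refine Finset.card_le_one.2 fun e he e' he' => ?_
        have he := (Finset.mem_filter.1 he).2
        have he' := (Finset.mem_filter.1 he').2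
        exact hhead e e' (he.trans he'.symm) (he ▸ hi)
      exact_mod_cast this
    · rw [hg0 i hi, mul_zero]
  rw [hdec]
  refine ⟨add_nonneg (Finset.sum_nonneg h1) (Finset.sum_nonneg h2), fun hle => ?_⟩
  have e1 := Finset.sum_nonneg h1
  have e2 := Finset.sum_nonneg h2
  have z1 := (Finset.sum_eq_zero_iff_of_nonneg h1).1 (le_antisymm (by linarith) e1)
  have z2 := (Finset.sum_eq_zero_iff_of_nonneg h2).1 (le_antisymm (by linarith) e2)
  refine ⟨fun e => sub_eq_zero.1 (z1 e (Finset.mem_univ _)), fun i hi => ?_⟩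
  by_contra hno
  push Not at hno
  have := z2 i (Finset.mem_univ _)
  rw [Finset.filter_false_of_mem fun e _ => hno e] at this
  simp [hi] at this

/-! ### The entropy as a weighted sum, and local consistency -/

/-- The coefficient with which the entropy term of a coordinate enters `-H_B`, up to sign. -/
def weight : Stat G X → ℝ :=
  Sum.elim (fun p => -((G.degree p.1 : ℝ) - 1)) (fun _ => 1)

theorem sum_weight_mul (φ : Stat G X → ℝ) :
    ∑ a, weight G X a * φ a = ∑ e : G.edgeSet, ∑ z : EdgeSetting G X e, φ (Sum.inr ⟨e, z⟩)
      - ∑ i, ((G.degree i : ℝ) - 1) * ∑ x : X i, φ (Sum.inl ⟨i, x⟩) := by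
  rw [Fintype.sum_sum_type, Fintype.sum_sigma, Fintype.sum_sigma]
  simp only [weight, Sum.elim_inl, Sum.elim_inr, one_mul, Finset.mul_sum, neg_mul,
    Finset.sum_neg_distrib]
  ring

theorem neg_betheEntropy_eq (m : MarginalVec G X) :
    -betheEntropy G X m = ∑ a, weight G X a * (m a * Real.log (m a)) := by
  rw [sum_weight_mul, betheEntropy]
  simp only [Real.negMulLog, neg_mul, Finset.sum_neg_distrib, mul_neg]
  ring

/-- The node marginals have total mass `c` and are the marginals of the edge marginals. -/
structure LocallyConsistent (c : ℝ) (m : MarginalVec G X) : Prop where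
  mass : ∀ i, ∑ x : X i, m (Sum.inl ⟨i, x⟩) = c
  marg : ∀ (e : G.edgeSet) (v : V) (hv : v ∈ (e : Sym2 V)) (x : X v),
    m (Sum.inl ⟨v, x⟩)
      = ∑ z : EdgeSetting G X e, if z ⟨v, hv⟩ = x then m (Sum.inr ⟨e, z⟩) else 0

variable {G X}

theorem locallyConsistent_suffStat (y : ∀ i, X i) :
    LocallyConsistent G X 1 (suffStat G X y) := by
  constructor
  · intro i
    simp [suffStat]
  · intro e v hv x
    simp only [suffStat, Sum.elim_inl, Sum.elim_inr]
    rw [Finset.sum_eq_single fun v : {v : V // v ∈ (e : Sym2 V)} => y v]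
    · simp
    · intro z _ hz
      simp [Ne.symm hz]
    · simp

theorem LocallyConsistent.sub {c d : ℝ} {m n : MarginalVec G X}
    (hm : LocallyConsistent G X c m) (hn : LocallyConsistent G X d n) :
    LocallyConsistent G X (c - d) (m - n) := by
  constructor
  · intro i
    simp only [PiLp.sub_apply, Finset.sum_sub_distrib, hm.mass, hn.mass]
  · intro e v hv x
    simp only [PiLp.sub_apply]
    rw [hm.marg e v hv, hn.marg e v hv, ← Finset.sum_sub_distrib]
    refine Finset.sum_congr rfl fun z _ => ?_
    split_ifs <;> simp

theorem LocallyConsistent.smul {c : ℝ} {m : MarginalVec G X}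
    (hm : LocallyConsistent G X c m) (r : ℝ) :
    LocallyConsistent G X (r * c) (r • m) := by
  constructor
  · intro i
    simp only [PiLp.smul_apply, smul_eq_mul, ← Finset.mul_sum, hm.mass]
  · intro e v hv x
    simp only [PiLp.smul_apply, smul_eq_mul]
    rw [hm.marg e v hv, Finset.mul_sum]
    refine Finset.sum_congr rfl fun z _ => ?_
    split_ifs <;> simp

theorem sum_smul_suffStat_apply (p : (∀ i, X i) → ℝ) (a : Stat G X) :
    (∑ y, p y • suffStat G X y) a = ∑ y, p y * suffStat G X y a := by
  rw [WithLp.ofLp_sum, Finset.sum_apply]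
  rfl

theorem locallyConsistent_of_mem {m : MarginalVec G X} (hm : m ∈ marginalPolytope G X) :
    LocallyConsistent G X 1 m := by
  obtain ⟨p, hp, rfl⟩ := hm
  constructor
  · intro i
    simp only [sum_smul_suffStat_apply]
    rw [Finset.sum_comm]
    simp only [← Finset.mul_sum, (locallyConsistent_suffStat _).mass, mul_one, hp.2]
  · intro e v hv x
    simp only [sum_smul_suffStat_apply]
    simp only [(locallyConsistent_suffStat _).marg e v hv, Finset.mul_sum]
    rw [Finset.sum_comm]
    refine Finset.sum_congr rfl fun z _ => ?_
    split_ifs <;> simp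

theorem nonneg_of_mem {m : MarginalVec G X} (hm : m ∈ marginalPolytope G X) (a : Stat G X) :
    0 ≤ m a := by
  obtain ⟨p, hp, rfl⟩ := hm
  rw [sum_smul_suffStat_apply]
  refine Finset.sum_nonneg fun y _ => mul_nonneg (hp.1 y) ?_
  rcases a with a | a <;> simp only [suffStat, Sum.elim_inl, Sum.elim_inr] <;>
    split_ifs <;> norm_num

theorem LocallyConsistent.sum_comp {c : ℝ} {m : MarginalVec G X}
    (hm : LocallyConsistent G X c m) (e : G.edgeSet) (v : V) (hv : v ∈ (e : Sym2 V))
    (F : X v → ℝ) :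
    ∑ z : EdgeSetting G X e, F (z ⟨v, hv⟩) * m (Sum.inr ⟨e, z⟩)
      = ∑ x, F x * m (Sum.inl ⟨v, x⟩) := by
  simp only [hm.marg e v hv, Finset.mul_sum]
  rw [Finset.sum_comm]
  refine Finset.sum_congr rfl fun z _ => ?_
  simp

/-- A one-state node carries the whole mass. Hence differences of marginal vectors vanish there and
marginals never do, which supplies the hypothesis `hg0` of `orientation_sum_nonneg`. -/
theorem LocallyConsistent.node_eq_mass {c : ℝ} {m : MarginalVec G X}
    (hm : LocallyConsistent G X c m) {i : V} (hi : ¬ Nontrivial (X i)) (x : X i) :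
    m (Sum.inl ⟨i, x⟩) = c := by
  have := not_nontrivial_iff_subsingleton.1 hi
  rw [← hm.mass i, Fintype.sum_subsingleton _ x]

/-- Lets the tail state vary while the head state is fixed, in the equality cases of the orientation
inequality. -/
theorem exists_edgeSetting [∀ i, Nonempty (X i)] (e : G.edgeSet) {s t : V} (hst : s ≠ t)
    (hs : s ∈ (e : Sym2 V)) (ht : t ∈ (e : Sym2 V)) (x : X s) (y : X t) :
    ∃ z : EdgeSetting G X e, z ⟨s, hs⟩ = x ∧ z ⟨t, ht⟩ = y := by
  refine ⟨fun v => Function.update (Function.update (fun _ => Classical.arbitrary _) s x) t y v,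
    ?_, ?_⟩
  · simp [Function.update_of_ne hst]
  · simp

/-- The second derivative of `-H_B` is positive definite where all marginals are positive. -/
theorem hessian_pos [∀ i, Nonempty (X i)]
    (hH : ConvexOn ℝ (marginalPolytope G X) (fun m => -betheEntropy G X m))
    {m δ : MarginalVec G X} (hm : LocallyConsistent G X 1 m) (hpos : ∀ a, 0 < m a)
    (hδ : LocallyConsistent G X 0 δ) (hne : δ ≠ 0) :
    0 < ∑ a, weight G X a * (δ a ^ 2 / m a) := by
  obtain ⟨t, h, hth, hedge, hhead⟩ := exists_orientation G X hH
  have htm : ∀ e : G.edgeSet, t e ∈ (e : Sym2 V) := fun e => by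
    rw [hedge e]; exact Sym2.mem_mk_left _ _
  have hhm : ∀ e : G.edgeSet, h e ∈ (e : Sym2 V) := fun e => by
    rw [hedge e]; exact Sym2.mem_mk_right _ _
  rw [sum_weight_mul]
  set r : Stat G X → ℝ := fun a => δ a / m a with hr
  have hrm : ∀ a, δ a = r a * m a := fun a => (div_mul_cancel₀ _ (hpos a).ne').symm
  have hsq : ∀ a, δ a ^ 2 / m a = r a ^ 2 * m a := fun a => by
    rw [hrm a, div_eq_iff (hpos a).ne']; ring
  simp only [hsq]
  -- The tail ratio is the conditional mean of the edge ratio given the tail state, so the gap `A_e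
  -- - g_{t(e)}` is a conditional variance.
  have hid : ∀ e : G.edgeSet, ∑ z : EdgeSetting G X e,
      (r (Sum.inr ⟨e, z⟩) - r (Sum.inl ⟨t e, z ⟨t e, htm e⟩⟩)) ^ 2 * m (Sum.inr ⟨e, z⟩)
      = ∑ z : EdgeSetting G X e, r (Sum.inr ⟨e, z⟩) ^ 2 * m (Sum.inr ⟨e, z⟩)
        - ∑ x, r (Sum.inl ⟨t e, x⟩) ^ 2 * m (Sum.inl ⟨t e, x⟩) := by
    intro e
    have h1 := hδ.sum_comp e (t e) (htm e) (fun x => r (Sum.inl ⟨t e, x⟩))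
    have h2 := hm.sum_comp e (t e) (htm e) (fun x => r (Sum.inl ⟨t e, x⟩) ^ 2)
    simp only [hrm] at h1
    have h3 : ∑ x, r (Sum.inl ⟨t e, x⟩) * (r (Sum.inl ⟨t e, x⟩) * m (Sum.inl ⟨t e, x⟩))
        = ∑ x, r (Sum.inl ⟨t e, x⟩) ^ 2 * m (Sum.inl ⟨t e, x⟩) :=
      Finset.sum_congr rfl fun x _ => by ring
    rw [h3] at h1
    have h4 : ∀ z : EdgeSetting G X e,
        (r (Sum.inr ⟨e, z⟩) - r (Sum.inl ⟨t e, z ⟨t e, htm e⟩⟩)) ^ 2 * m (Sum.inr ⟨e, z⟩)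
        = r (Sum.inr ⟨e, z⟩) ^ 2 * m (Sum.inr ⟨e, z⟩)
          - 2 * (r (Sum.inl ⟨t e, z ⟨t e, htm e⟩⟩) * (r (Sum.inr ⟨e, z⟩) * m (Sum.inr ⟨e, z⟩)))
          + r (Sum.inl ⟨t e, z ⟨t e, htm e⟩⟩) ^ 2 * m (Sum.inr ⟨e, z⟩) := fun z => by ring
    simp only [h4, Finset.sum_add_distrib, Finset.sum_sub_distrib, ← Finset.mul_sum, h1, h2]
    ring
  have hnn : ∀ e : G.edgeSet, ∀ z ∈ (Finset.univ : Finset (EdgeSetting G X e)),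
      0 ≤ (r (Sum.inr ⟨e, z⟩) - r (Sum.inl ⟨t e, z ⟨t e, htm e⟩⟩)) ^ 2 * m (Sum.inr ⟨e, z⟩) :=
    fun e z _ => mul_nonneg (sq_nonneg _) (hpos _).le
  obtain ⟨-, hzero⟩ := orientation_sum_nonneg hth hedge hhead
    (fun e => ∑ z : EdgeSetting G X e, r (Sum.inr ⟨e, z⟩) ^ 2 * m (Sum.inr ⟨e, z⟩))
    (fun i => ∑ x, r (Sum.inl ⟨i, x⟩) ^ 2 * m (Sum.inl ⟨i, x⟩))
    (fun e => by
      have := Finset.sum_nonneg (hnn e)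
      rw [hid e] at this
      linarith)
    (fun i => Finset.sum_nonneg fun x _ => mul_nonneg (sq_nonneg _) (hpos _).le)
    (fun i hi => Finset.sum_eq_zero fun x _ => by
      simp [hr, hδ.node_eq_mass hi x])
  by_contra hle
  obtain ⟨hA, hg⟩ := hzero (not_lt.1 hle)
  have hrt : ∀ (e : G.edgeSet) (z : EdgeSetting G X e),
      r (Sum.inr ⟨e, z⟩) = r (Sum.inl ⟨t e, z ⟨t e, htm e⟩⟩) := by
    intro e z
    have h0 := hid e
    rw [hA e, sub_self] at h0
    have := (Finset.sum_eq_zero_iff_of_nonneg (hnn e)).1 h0 z (Finset.mem_univ _)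
    have := (mul_eq_zero.1 this).resolve_right (hpos _).ne'
    exact sub_eq_zero.1 (pow_eq_zero_iff two_ne_zero |>.1 this)
  -- Maximum principle: at a head, the ratio is an average of tail ratios. If its square is maximal
  -- and nonzero, the tail ratio is constant, which contradicts that `δ` has mass zero at the tail.
  have hnode : ∀ p : (Σ i, X i), r (Sum.inl p) = 0 := by
    intro p'
    have : Nonempty (Σ i, X i) := ⟨p'⟩
    obtain ⟨⟨i, x⟩, hmax⟩ := Finite.exists_max fun p : (Σ i, X i) => r (Sum.inl p) ^ 2
    by_contra hp'
    have hp : r (Sum.inl ⟨i, x⟩) ≠ 0 := by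
      intro h0
      have := hmax p'
      rw [h0] at this
      exact hp' (pow_eq_zero_iff two_ne_zero |>.1 (le_antisymm (by simpa using this)
        (sq_nonneg _)))
    obtain ⟨e, rfl⟩ := hg i (ne_of_gt (lt_of_lt_of_le
      (mul_pos (pow_pos (abs_pos.2 hp) 2) (hpos (Sum.inl ⟨i, x⟩)))
      (by
        rw [sq_abs]
        exact Finset.single_le_sum (f := fun x => r (Sum.inl ⟨i, x⟩) ^ 2 * m (Sum.inl ⟨i, x⟩))
          (fun x _ => mul_nonneg (sq_nonneg _) (hpos _).le) (Finset.mem_univ x))))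
    set ρ := r (Sum.inl ⟨h e, x⟩) with hρ
    have hδe := hδ.marg e (h e) (hhm e) x
    have hme := hm.marg e (h e) (hhm e) x
    simp only [hrm, hrt] at hδe
    rw [← hρ] at hδe
    have hterm : ∀ z ∈ (Finset.univ : Finset (EdgeSetting G X e)),
        0 ≤ if z ⟨h e, hhm e⟩ = x then
          (r (Sum.inl ⟨t e, z ⟨t e, htm e⟩⟩) - ρ) ^ 2 * m (Sum.inr ⟨e, z⟩) else 0 := by
      intro z _
      split_ifs
      · exact mul_nonneg (sq_nonneg _) (hpos _).le
      · exact le_rfl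
    have hsum : ∑ z : EdgeSetting G X e, (if z ⟨h e, hhm e⟩ = x then
        (r (Sum.inl ⟨t e, z ⟨t e, htm e⟩⟩) - ρ) ^ 2 * m (Sum.inr ⟨e, z⟩) else 0) ≤ 0 := by
      -- Maximality bounds the squared tail ratio by `ρ ^ 2`, hence `(r - ρ) ^ 2 ≤ 2 * ρ ^ 2 - 2 * ρ
      -- * r`; weighted by the edge marginals, the right side sums to zero.
      have hb : ∑ z : EdgeSetting G X e, (if z ⟨h e, hhm e⟩ = x then
        (r (Sum.inl ⟨t e, z ⟨t e, htm e⟩⟩) - ρ) ^ 2 * m (Sum.inr ⟨e, z⟩) else 0)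
        ≤ ∑ z : EdgeSetting G X e, ((2 * ρ ^ 2) *
            (if z ⟨h e, hhm e⟩ = x then m (Sum.inr ⟨e, z⟩) else 0)
          - (2 * ρ) * if z ⟨h e, hhm e⟩ = x then
            r (Sum.inl ⟨t e, z ⟨t e, htm e⟩⟩) * m (Sum.inr ⟨e, z⟩) else 0) := by
        refine Finset.sum_le_sum fun z _ => ?_
        split_ifs
        · have := mul_le_mul_of_nonneg_right (hmax ⟨t e, z ⟨t e, htm e⟩⟩)
            (hpos (Sum.inr ⟨e, z⟩)).le
          simp only at this
          nlinarith
        · simp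
      rw [Finset.sum_sub_distrib, ← Finset.mul_sum, ← Finset.mul_sum, ← hδe, ← hme] at hb
      linarith
    have hz := (Finset.sum_eq_zero_iff_of_nonneg hterm).1
      (le_antisymm hsum (Finset.sum_nonneg hterm))
    have hconst : ∀ x', r (Sum.inl ⟨t e, x'⟩) = ρ := by
      intro x'
      obtain ⟨z, hz1, hz2⟩ := exists_edgeSetting e (hth e) (htm e) (hhm e) x' x
      have := hz z (Finset.mem_univ _)
      rw [if_pos hz2, hz1] at this
      have := (mul_eq_zero.1 this).resolve_right (hpos _).ne'
      exact sub_eq_zero.1 (pow_eq_zero_iff two_ne_zero |>.1 this)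
    have h0 := hδ.mass (t e)
    simp only [hrm, hconst, ← Finset.mul_sum, hm.mass, mul_one] at h0
    exact hp h0
  refine hne (PiLp.ext fun a => ?_)
  rw [hrm a]
  rcases a with p | ⟨e, z⟩
  · simp [hnode]
  · simp [hrt, hnode]

/-- If some marginals vanish, then the weights of the vanishing coordinates have a positive sum
against every vector of positive marginals. -/
theorem sum_weight_zero_pos [∀ i, Nonempty (X i)]
    (hH : ConvexOn ℝ (marginalPolytope G X) (fun m => -betheEntropy G X m))
    {m c : MarginalVec G X} (hm : LocallyConsistent G X 1 m) (hm0 : ∀ a, 0 ≤ m a)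
    (hc : LocallyConsistent G X 1 c) (hcpos : ∀ a, 0 < c a) (hz : ∃ a, m a = 0) :
    0 < ∑ a, weight G X a * (if m a = 0 then c a else 0) := by
  obtain ⟨t, h, hth, hedge, hhead⟩ := exists_orientation G X hH
  have htm : ∀ e : G.edgeSet, t e ∈ (e : Sym2 V) := fun e => by
    rw [hedge e]; exact Sym2.mem_mk_left _ _
  have hhm : ∀ e : G.edgeSet, h e ∈ (e : Sym2 V) := fun e => by
    rw [hedge e]; exact Sym2.mem_mk_right _ _
  have hedge0 : ∀ (e : G.edgeSet) (v : V) (hv : v ∈ (e : Sym2 V)) (z : EdgeSetting G X e),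
      m (Sum.inl ⟨v, z ⟨v, hv⟩⟩) = 0 → m (Sum.inr ⟨e, z⟩) = 0 := by
    intro e v hv z h0
    rw [hm.marg e v hv, Finset.sum_eq_zero_iff_of_nonneg] at h0
    · simpa using h0 z (Finset.mem_univ _)
    · intro z' _
      split_ifs
      exacts [hm0 _, le_rfl]
  have hnn : ∀ a, 0 ≤ if m a = 0 then c a else 0 := fun a => by
    split_ifs
    exacts [(hcpos a).le, le_rfl]
  rw [sum_weight_mul]
  have hgt : ∀ e : G.edgeSet, ∑ x, (if m (Sum.inl ⟨t e, x⟩) = 0 then c (Sum.inl ⟨t e, x⟩) else 0)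
      = ∑ z : EdgeSetting G X e,
        if m (Sum.inl ⟨t e, z ⟨t e, htm e⟩⟩) = 0 then c (Sum.inr ⟨e, z⟩) else 0 := by
    intro e
    have := hc.sum_comp e (t e) (htm e) (fun x => if m (Sum.inl ⟨t e, x⟩) = 0 then 1 else 0)
    simp only [ite_mul, one_mul, zero_mul] at this
    exact this.symm
  have hterm : ∀ e : G.edgeSet, ∀ z ∈ (Finset.univ : Finset (EdgeSetting G X e)),
      (if m (Sum.inl ⟨t e, z ⟨t e, htm e⟩⟩) = 0 then c (Sum.inr ⟨e, z⟩) else 0)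
        ≤ if m (Sum.inr ⟨e, z⟩) = 0 then c (Sum.inr ⟨e, z⟩) else 0 := by
    intro e z _
    split_ifs with h1 h2
    · exact le_rfl
    · exact absurd (hedge0 e _ _ z h1) h2
    · exact (hcpos _).le
    · exact le_rfl
  obtain ⟨-, hzero⟩ := orientation_sum_nonneg hth hedge hhead
    (fun e => ∑ z : EdgeSetting G X e,
      if m (Sum.inr ⟨e, z⟩) = 0 then c (Sum.inr ⟨e, z⟩) else 0)
    (fun i => ∑ x, if m (Sum.inl ⟨i, x⟩) = 0 then c (Sum.inl ⟨i, x⟩) else 0)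
    (fun e => by rw [hgt e]; exact Finset.sum_le_sum (hterm e))
    (fun i => Finset.sum_nonneg fun x _ => hnn _)
    (fun i hi => Finset.sum_eq_zero fun x _ => by simp [hm.node_eq_mass hi x])
  by_contra hle
  obtain ⟨hA, hg⟩ := hzero (not_lt.1 hle)
  have htail : ∀ (e : G.edgeSet) (z : EdgeSetting G X e),
      m (Sum.inr ⟨e, z⟩) = 0 → m (Sum.inl ⟨t e, z ⟨t e, htm e⟩⟩) = 0 := by
    intro e z h0
    have := (Finset.sum_eq_sum_iff_of_le (hterm e)).1 ((hgt e).symm.trans (hA e).symm) z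
      (Finset.mem_univ _)
    by_contra h1
    rw [if_neg h1, if_pos h0] at this
    exact (hcpos _).ne this
  -- A zero at a head state kills all edge settings above it, and equality carries these zeros to
  -- every tail state, so the tail would have no mass.
  have hnode : ∀ (i : V) (x : X i), m (Sum.inl ⟨i, x⟩) ≠ 0 := by
    intro i x h0
    obtain ⟨e, rfl⟩ := hg i (ne_of_gt (lt_of_lt_of_le (hcpos (Sum.inl ⟨i, x⟩)) (by
      have := Finset.single_le_sum
        (f := fun x => if m (Sum.inl ⟨i, x⟩) = 0 then c (Sum.inl ⟨i, x⟩) else 0)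
        (fun x _ => hnn _) (Finset.mem_univ x)
      simpa only [if_pos h0] using this)))
    have hall : ∀ x', m (Sum.inl ⟨t e, x'⟩) = 0 := by
      intro x'
      obtain ⟨z, rfl, rfl⟩ := exists_edgeSetting e (hth e) (htm e) (hhm e) x' x
      exact htail e z (hedge0 e _ _ z h0)
    have h1 := hm.mass (t e)
    simp only [hall, Finset.sum_const_zero] at h1
    exact zero_ne_one h1
  obtain ⟨⟨i, x⟩ | ⟨e, z⟩, h0⟩ := hz
  · exact hnode i x h0
  · exact hnode _ _ (htail e z h0)

/-! ### Positivity of minimizers and strong convexity -/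

theorem convex_marginalPolytope : Convex ℝ (marginalPolytope G X) := by
  rintro _ ⟨p, hp, rfl⟩ _ ⟨q, hq, rfl⟩ a b ha hb hab
  refine ⟨a • p + b • q, convex_stdSimplex ℝ _ hp hq ha hb hab, ?_⟩
  simp only [Pi.add_apply, Pi.smul_apply, smul_eq_mul, add_smul, mul_smul,
    Finset.sum_add_distrib, Finset.smul_sum]

/-- The uniform distribution works, since every coordinate equals `1` for some configuration. -/
theorem exists_mem_marginalPolytope_pos [∀ i, Nonempty (X i)] :
    ∃ c ∈ marginalPolytope G X, ∀ a, 0 < c a := by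
  have hN : (0 : ℝ) < Fintype.card (∀ i, X i) := by exact_mod_cast Fintype.card_pos
  refine ⟨∑ y, (Fintype.card (∀ i, X i) : ℝ)⁻¹ • suffStat G X y,
    ⟨fun _ => (Fintype.card (∀ i, X i) : ℝ)⁻¹, ⟨fun _ => (inv_pos.2 hN).le, ?_⟩, rfl⟩, fun a => ?_⟩
  · rw [Finset.sum_const, Finset.card_univ, nsmul_eq_mul, mul_inv_cancel₀ hN.ne']
  · have hex : ∃ y, suffStat G X y a = 1 := by
      rcases a with ⟨i, x⟩ | ⟨e, z⟩
      · exact ⟨Function.update (fun _ => Classical.arbitrary _) i x, by simp [suffStat]⟩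
      · refine ⟨fun v => if hv : v ∈ (e : Sym2 V) then z ⟨v, hv⟩ else Classical.arbitrary _, ?_⟩
        simp only [suffStat, Sum.elim_inr]
        rw [if_pos]
        funext v
        exact dif_pos v.2
    obtain ⟨y, hy⟩ := hex
    rw [sum_smul_suffStat_apply]
    refine Finset.sum_pos' (fun y _ => mul_nonneg (inv_pos.2 hN).le
      (nonneg_of_mem (suffStat_mem_marginalPolytope G X y) a)) ⟨y, Finset.mem_univ _, ?_⟩
    rw [hy, mul_one]
    exact inv_pos.2 hN

/-- The difference quotient of `u log u` diverges only at `x = 0`, where it equals `y log s + y log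
y`; removing the logarithm leaves a finite limit. -/
theorem exists_tendsto_entropy_slope {x y : ℝ} (hy : 0 < y) :
    ∃ D, Tendsto (fun s : ℝ => s⁻¹ * ((x + s * (y - x)) * Real.log (x + s * (y - x))
      - x * Real.log x) - Real.log s * (if x = 0 then y else 0)) (𝓝[>] 0) (𝓝 D) := by
  by_cases hx : x = 0
  · subst hx
    refine ⟨y * Real.log y, tendsto_const_nhds.congr' ?_⟩
    filter_upwards [self_mem_nhdsWithin] with s hs
    have hs : 0 < s := hs
    simp only [zero_add, sub_zero, if_true, zero_mul]
    rw [Real.log_mul hs.ne' hy.ne']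
    field_simp
    ring
  · have h1 : HasDerivAt (fun s : ℝ => x + s * (y - x)) (1 * (y - x)) 0 :=
      ((hasDerivAt_id 0).mul_const _).const_add x
    have h2 : HasDerivAt (fun u : ℝ => u * Real.log u) (Real.log x + 1)
        ((fun s : ℝ => x + s * (y - x)) 0) := by
      simpa using Real.hasDerivAt_mul_log hx
    have h3 := (h2.comp (0 : ℝ) h1).tendsto_slope_zero_right
    refine ⟨_, h3.congr fun s => ?_⟩
    simp [hx]

/-- A minimizer of `-H_B + ℓ` has positive marginals if the difference quotients of `ℓ` at it
are bounded above along segments. -/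
theorem pos_of_isMinOn [∀ i, Nonempty (X i)]
    (hH : ConvexOn ℝ (marginalPolytope G X) (fun m => -betheEntropy G X m))
    {m : MarginalVec G X} (hm : m ∈ marginalPolytope G X) (ℓ : MarginalVec G X → ℝ)
    (hℓ : ∀ c ∈ marginalPolytope G X, ∃ C, ∀ s ∈ Set.Ioc (0 : ℝ) 1,
      ℓ (m + s • (c - m)) - ℓ m ≤ s * C)
    (hmin : IsMinOn (fun m => -betheEntropy G X m + ℓ m) (marginalPolytope G X) m)
    (a : Stat G X) : 0 < m a := by
  by_contra hneg
  have ha : m a = 0 := le_antisymm (not_lt.1 hneg) (nonneg_of_mem hm a)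
  obtain ⟨c, hc, hcpos⟩ := exists_mem_marginalPolytope_pos (G := G) (X := X)
  obtain ⟨C, hC⟩ := hℓ c hc
  have hN := sum_weight_zero_pos hH (locallyConsistent_of_mem hm) (nonneg_of_mem hm)
    (locallyConsistent_of_mem hc) hcpos ⟨a, ha⟩
  set N := ∑ a, weight G X a * (if m a = 0 then c a else 0)
  choose D hD using fun a => exists_tendsto_entropy_slope (x := m a) (hcpos a)
  have hlim := tendsto_finsetSum Finset.univ fun a _ => (hD a).const_mul (weight G X a)
  -- Minimality keeps the slope of `-H_B` above `-C`; subtracting `N * log s` with `N > 0` then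
  -- gives `+∞`, against the finite limit.
  refine not_tendsto_nhds_of_tendsto_atTop ?_ _ hlim
  have hlog : Tendsto (fun s : ℝ => -C + -(Real.log s) * N) (𝓝[>] 0) atTop :=
    tendsto_atTop_add_const_left _ _
      ((tendsto_neg_atBot_atTop.comp Real.tendsto_log_nhdsGT_zero).atTop_mul_const hN)
  refine tendsto_atTop_mono' _ ?_ hlog
  filter_upwards [Ioc_mem_nhdsGT (zero_lt_one' ℝ)] with s hs
  have hmem : m + s • (c - m) ∈ marginalPolytope G X :=
    convex_marginalPolytope.add_smul_sub_mem hm hc ⟨hs.1.le, hs.2⟩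
  have h1 := isMinOn_iff.1 hmin _ hmem
  have h2 := hC s hs
  simp only [neg_betheEntropy_eq] at h1
  have hsum : ∑ a, weight G X a * (s⁻¹ * ((m a + s * (c a - m a)) * Real.log (m a + s * (c a - m a))
      - m a * Real.log (m a)) - Real.log s * (if m a = 0 then c a else 0))
      = s⁻¹ * (∑ a, weight G X a * ((m + s • (c - m)) a * Real.log ((m + s • (c - m)) a))
        - ∑ a, weight G X a * (m a * Real.log (m a))) - Real.log s * N := by
    rw [← Finset.sum_sub_distrib, Finset.mul_sum, Finset.mul_sum, ← Finset.sum_sub_distrib]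
    refine Finset.sum_congr rfl fun a _ => ?_
    simp only [PiLp.add_apply, PiLp.smul_apply, PiLp.sub_apply, smul_eq_mul]
    ring
  rw [hsum]
  have h3 : -C ≤ s⁻¹ * (∑ a, weight G X a * ((m + s • (c - m)) a
      * Real.log ((m + s • (c - m)) a)) - ∑ a, weight G X a * (m a * Real.log (m a))) := by
    rw [inv_mul_eq_div, le_div_iff₀ hs.1]
    linarith
  linarith

/-! ### Uniform strong convexity away from vanishing marginals -/

variable (G X) in
/-- The marginal vectors in the polytope all of whose coordinates are at least `ε`. -/
def innerPolytope (ε : ℝ) : Set (MarginalVec G X) :=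
  {m | m ∈ marginalPolytope G X ∧ ∀ a, ε ≤ m a}

theorem convex_innerPolytope (ε : ℝ) : Convex ℝ (innerPolytope G X ε) := by
  intro m hm n hn a b ha hb hab
  refine ⟨convex_marginalPolytope hm.1 hn.1 ha hb hab, fun i => ?_⟩
  simp only [PiLp.add_apply, PiLp.smul_apply, smul_eq_mul]
  calc ε = a * ε + b * ε := by rw [← add_mul, hab, one_mul]
    _ ≤ _ := add_le_add (mul_le_mul_of_nonneg_left (hm.2 i) ha)
      (mul_le_mul_of_nonneg_left (hn.2 i) hb)

theorem isCompact_innerPolytope (ε : ℝ) : IsCompact (innerPolytope G X ε) := by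
  refine (isCompact_marginalPolytope G X).inter_right (t := {m | ∀ a, ε ≤ m a}) ?_
  simp only [Set.ofPred_forall]
  exact isClosed_iInter fun a => isClosed_le continuous_const (by fun_prop)

theorem isClosed_setOf_locallyConsistent (c : ℝ) :
    IsClosed {δ : MarginalVec G X | LocallyConsistent G X c δ} := by
  have : {δ : MarginalVec G X | LocallyConsistent G X c δ}
      = {δ | ∀ i, ∑ x : X i, δ (Sum.inl ⟨i, x⟩) = c} ∩
        {δ | ∀ (e : G.edgeSet) (v : V) (hv : v ∈ (e : Sym2 V)) (x : X v), δ (Sum.inl ⟨v, x⟩)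
          = ∑ z : EdgeSetting G X e, if z ⟨v, hv⟩ = x then δ (Sum.inr ⟨e, z⟩) else 0} :=
    Set.ext fun δ => ⟨fun h => ⟨h.1, h.2⟩, fun h => ⟨h.1, h.2⟩⟩
  rw [this]
  simp only [Set.ofPred_forall]
  refine IsClosed.inter (isClosed_iInter fun i => isClosed_eq (by fun_prop) continuous_const)
    (isClosed_iInter fun e => isClosed_iInter fun v => isClosed_iInter fun hv =>
      isClosed_iInter fun x => isClosed_eq (by fun_prop) (continuous_finsetSum _ fun z _ => ?_))
  split_ifs <;> fun_prop

/-- By homogeneity in `δ` it suffices to take unit vectors, where the positive continuous form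
attains its minimum on a compact set. -/
theorem exists_hessian_lower_bound [∀ i, Nonempty (X i)]
    (hH : ConvexOn ℝ (marginalPolytope G X) (fun m => -betheEntropy G X m))
    {ε : ℝ} (hε : 0 < ε) :
    ∃ σ > 0, ∀ m ∈ innerPolytope G X ε, ∀ δ, LocallyConsistent G X 0 δ →
      σ * ‖δ‖ ^ 2 ≤ ∑ a, weight G X a * (δ a ^ 2 / m a) := by
  set S : Set (MarginalVec G X × MarginalVec G X) := innerPolytope G X ε ×ˢ
    (Metric.sphere 0 1 ∩ {δ | LocallyConsistent G X 0 δ}) with hS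
  have hScomp : IsCompact S := (isCompact_innerPolytope ε).prod
    ((isCompact_sphere _ _).inter_right (isClosed_setOf_locallyConsistent 0))
  have hcont : ContinuousOn (fun p : MarginalVec G X × MarginalVec G X =>
      ∑ a, weight G X a * (p.2 a ^ 2 / p.1 a)) S := by
    refine continuousOn_finsetSum _ fun a _ => continuousOn_const.mul
      (ContinuousOn.div (by fun_prop) (by fun_prop) fun p hp => ?_)
    exact (hε.trans_le (hp.1.2 a)).ne'
  obtain ⟨σ, hσ, hle⟩ : ∃ σ > 0, ∀ p ∈ S, σ ≤ ∑ a, weight G X a * (p.2 a ^ 2 / p.1 a) := by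
    rcases S.eq_empty_or_nonempty with he | hne
    · exact ⟨1, one_pos, by simp [he]⟩
    · obtain ⟨p, hp, hmin⟩ := hScomp.exists_isMinOn hne hcont
      refine ⟨_, hessian_pos hH (locallyConsistent_of_mem hp.1.1)
        (fun a => hε.trans_le (hp.1.2 a)) hp.2.2 ?_, fun q hq => isMinOn_iff.1 hmin q hq⟩
      intro h0
      have := hp.2.1
      rw [h0] at this
      simp at this
  refine ⟨σ, hσ, fun m hm δ hδ => ?_⟩
  rcases eq_or_ne δ 0 with rfl | h0
  · simp
  · have hn : ‖δ‖ ≠ 0 := norm_ne_zero_iff.2 h0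
    have hmem : (m, ‖δ‖⁻¹ • δ) ∈ S := by
      refine ⟨hm, ?_, ?_⟩
      · simp [norm_smul, hn]
      · simpa using hδ.smul ‖δ‖⁻¹
    have := hle _ hmem
    have h2 : ∑ a, weight G X a * ((‖δ‖⁻¹ • δ) a ^ 2 / m a)
        = (‖δ‖ ^ 2)⁻¹ * ∑ a, weight G X a * (δ a ^ 2 / m a) := by
      rw [Finset.mul_sum]
      refine Finset.sum_congr rfl fun a _ => ?_
      simp only [PiLp.smul_apply, smul_eq_mul]
      ring
    simp only [h2] at this
    rwa [inv_mul_eq_div, le_div_iff₀ (by positivity)] at this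

/-- `-H_B` is strongly convex at midpoints, uniformly away from the vanishing of marginals. -/
theorem exists_midpoint_strongly_convex [∀ i, Nonempty (X i)]
    (hH : ConvexOn ℝ (marginalPolytope G X) (fun m => -betheEntropy G X m))
    {ε : ℝ} (hε : 0 < ε) :
    ∃ σ > 0, ∀ x ∈ innerPolytope G X ε, ∀ y ∈ innerPolytope G X ε,
      -betheEntropy G X ((1 / 2 : ℝ) • x + (1 / 2 : ℝ) • y)
        ≤ (1 / 2) * -betheEntropy G X x + (1 / 2) * -betheEntropy G X y
          - σ * ‖y - x‖ ^ 2 := by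
  obtain ⟨σ, hσ, hle⟩ := exists_hessian_lower_bound hH hε
  -- The function `g` below, with `σ‖d‖² s² / 2` subtracted, is convex; at `s = 1/2` the quadratic
  -- gains `1/4 - 1/8` of `σ‖d‖²`.
  refine ⟨σ / 8, by positivity, fun x hx y hy => ?_⟩
  set d := y - x with hd
  have hdlc : LocallyConsistent G X 0 d := by
    simpa using (locallyConsistent_of_mem hy.1).sub (locallyConsistent_of_mem hx.1)
  have hmem : ∀ s ∈ Set.Icc (0 : ℝ) 1, x + s • d ∈ innerPolytope G X ε := fun s hs =>
    (convex_innerPolytope ε).add_smul_sub_mem hx hy hs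
  have hpos : ∀ s ∈ Set.Icc (0 : ℝ) 1, ∀ a, 0 < x a + s * d a := fun s hs a =>
    hε.trans_le ((hmem s hs).2 a)
  let g : ℝ → ℝ := fun s =>
    ∑ a, weight G X a * ((x a + s * d a) * Real.log (x a + s * d a)) - σ * ‖d‖ ^ 2 / 2 * s ^ 2
  have hline : ∀ (s : ℝ) (a : Stat G X), HasDerivAt (fun s : ℝ => x a + s * d a) (d a) s :=
    fun s a => by simpa using ((hasDerivAt_id s).mul_const (d a)).const_add (x a)
  have hg : ConvexOn ℝ (Set.Icc (0 : ℝ) 1) g := by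
    refine convexOn_of_hasDerivWithinAt2_nonneg (convex_Icc 0 1)
      (f' := fun s => ∑ a, weight G X a * ((Real.log (x a + s * d a) + 1) * d a)
        - σ * ‖d‖ ^ 2 * s)
      (f'' := fun s => ∑ a, weight G X a * (d a ^ 2 / (x a + s * d a)) - σ * ‖d‖ ^ 2)
      ?_ ?_ ?_ ?_
    · refine Continuous.continuousOn (Continuous.sub
        (continuous_finsetSum _ fun a _ => continuous_const.mul ?_) (by fun_prop))
      exact Real.continuous_mul_log.comp (by fun_prop)
    · intro s hs
      refine HasDerivAt.hasDerivWithinAt (HasDerivAt.sub (HasDerivAt.fun_sum fun a _ =>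
        HasDerivAt.const_mul _ ?_) ?_)
      · exact (Real.hasDerivAt_mul_log (hpos s (interior_subset hs) a).ne').comp s (hline s a)
      · exact ((hasDerivAt_pow 2 s).const_mul (σ * ‖d‖ ^ 2 / 2)).congr_deriv (by push_cast; ring)
    · intro s hs
      refine HasDerivAt.hasDerivWithinAt (HasDerivAt.sub (HasDerivAt.fun_sum fun a _ =>
        HasDerivAt.const_mul _ ?_) ?_)
      · convert (((hline s a).log (hpos s (interior_subset hs) a).ne').add_const 1).mul_const
          (d a) using 1
        ring
      · simpa using (hasDerivAt_id s).const_mul (σ * ‖d‖ ^ 2)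
    · intro s hs
      have := hle _ (hmem s (interior_subset hs)) d hdlc
      simp only [PiLp.add_apply, PiLp.smul_apply, smul_eq_mul] at this
      exact sub_nonneg.2 this
  have hc := hg.2 (Set.left_mem_Icc.2 zero_le_one) (Set.right_mem_Icc.2 zero_le_one)
    (by norm_num : (0 : ℝ) ≤ 1 / 2) (by norm_num : (0 : ℝ) ≤ 1 / 2) (by norm_num)
  have hval : ∀ s, g s = -betheEntropy G X (x + s • d) - σ * ‖d‖ ^ 2 / 2 * s ^ 2 := by
    intro s
    rw [neg_betheEntropy_eq]
    rfl
  have e1 : x + (1 / 2 : ℝ) • d = (1 / 2 : ℝ) • x + (1 / 2 : ℝ) • y := by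
    rw [hd]; module
  have e2 : x + (1 : ℝ) • d = y := by rw [hd]; module
  simp only [smul_eq_mul, mul_zero, mul_one, zero_add, hval, e1, e2, zero_smul, add_zero] at hc
  nlinarith

/-! ### Regret of dual averaging -/

section DualAveraging

variable {E : Type*} [NormedAddCommGroup E] [InnerProductSpace ℝ E]

theorem inner_gradient_le_sub [CompleteSpace E] {U : Set E} {L : E → ℝ} (hL : ConvexOn ℝ U L)
    {x y : E} (hx : x ∈ U) (hy : y ∈ U) (hd : DifferentiableAt ℝ L x) :
    inner ℝ (gradient L x) (y - x) ≤ L y - L x := by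
  rw [inner_gradient_left]
  have h := (hd.hasFDerivAt.hasLineDerivAt (y - x)).tendsto_slope_zero_right
  refine le_of_tendsto h ?_
  filter_upwards [Ioc_mem_nhdsGT (zero_lt_one' ℝ)] with s hs
  have hc := hL.2 hx hy (sub_nonneg.2 hs.2) hs.1.le (by ring)
  have e : (1 - s) • x + s • y = x + s • (y - x) := by module
  rw [e, smul_eq_mul, smul_eq_mul] at hc
  rw [smul_eq_mul, inv_mul_eq_div, div_le_iff₀ hs.1]
  linarith

/-- `L` is bounded by some `B` on a closed `r`-thickening of `M`. The gradient inequality for a step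
of length `r` along `∇L(x)` gives `r‖∇L(x)‖ ≤ 2B`, so continuity of the gradient is not needed. -/
theorem exists_norm_gradient_le [FiniteDimensional ℝ E] {U M : Set E} {L : E → ℝ}
    (hL : ConvexOn ℝ U L) (hU : IsOpen U) (hL' : DifferentiableOn ℝ L U) (hM : IsCompact M)
    (hMU : M ⊆ U) : ∃ C, 0 ≤ C ∧ ∀ x ∈ M, ‖gradient L x‖ ≤ C := by
  have : ProperSpace E := FiniteDimensional.proper ℝ E
  obtain ⟨r, hr, hrU⟩ := hM.exists_cthickening_subset_open hU hMU
  obtain ⟨B, hB⟩ := hM.cthickening.exists_bound_of_continuousOn (hL'.continuousOn.mono hrU)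
  refine ⟨max 0 ((B + B) / r), le_max_left _ _, fun x hx => ?_⟩
  set g := gradient L x with hg
  rcases eq_or_ne g 0 with h0 | h0
  · rw [h0, norm_zero]; exact le_max_left _ _
  refine le_trans ?_ (le_max_right _ _)
  have hn : 0 < ‖g‖ := norm_pos_iff.2 h0
  have hxr : x ∈ Metric.cthickening r M := Metric.self_subset_cthickening M hx
  have hyr : x + (r / ‖g‖) • g ∈ Metric.cthickening r M := by
    refine Metric.mem_cthickening_of_dist_le _ x r M hx ?_
    rw [dist_eq_norm, add_sub_cancel_left, norm_smul, Real.norm_eq_abs,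
      abs_of_pos (div_pos hr hn), div_mul_cancel₀ _ hn.ne']
  have h1 := inner_gradient_le_sub hL (hMU hx) (hrU hyr)
    (hL'.differentiableAt (hU.mem_nhds (hMU hx)))
  rw [← hg, add_sub_cancel_left, inner_smul_right, real_inner_self_eq_norm_sq] at h1
  have h2 : r / ‖g‖ * ‖g‖ ^ 2 = ‖g‖ * r := by field_simp
  rw [h2] at h1
  have h3 := abs_le.1 (hB _ hxr)
  have h4 := abs_le.1 (hB _ hyr)
  rw [le_div_iff₀ hr]
  linarith

/-- Logarithmic regret of dual averaging with a strongly convex regularizer. -/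
theorem dualAveraging_regret (f : E → ℝ) {K : Set E} {μ g : ℕ → E} {σ C β : ℝ}
    (hβ : 0 ≤ β) (hσ : 0 < σ) (hK : ∀ k, μ k ∈ K) (hg : ∀ k, ‖g k‖ ≤ C)
    (hstrong : ∀ k : ℕ, 1 ≤ k → ∀ y ∈ K,
      f (μ k) + ((k : ℝ) + β)⁻¹ * inner ℝ (∑ j ∈ Finset.range k, g j) (μ k)
          + σ * ‖y - μ k‖ ^ 2
        ≤ f y + ((k : ℝ) + β)⁻¹ * inner ℝ (∑ j ∈ Finset.range k, g j) y)
    {u : E} (hu : ∀ k : ℕ, 1 ≤ k →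
      f (μ k) + ((k : ℝ) + β)⁻¹ * inner ℝ (∑ j ∈ Finset.range k, g j) (μ k)
        ≤ f u + ((k : ℝ) + β)⁻¹ * inner ℝ (∑ j ∈ Finset.range k, g j) u) :
    ∃ A B, ∀ t : ℕ, 1 ≤ t →
      ∑ k ∈ Finset.range t, (f (μ k) - f u + inner ℝ (g k) (μ k - u)) ≤ A + B * Real.log t := by
  set S : ℕ → E := fun k => ∑ j ∈ Finset.range k, g j with hS
  -- The potential minimized by `μ k`. It starts at `k = 1`, because its regularization weight
  -- vanishes at `k = 0` when `β = 0`.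
  set ψ : ℕ → E → ℝ := fun k y => ((k : ℝ) + β) * f y + inner ℝ (S k) y with hψ
  have hC : 0 ≤ C := (norm_nonneg _).trans (hg 0)
  have hSn : ∀ k, ‖S k‖ ≤ k * C := fun k => by
    refine (norm_sum_le _ _).trans ((Finset.sum_le_sum fun j _ => hg j).trans ?_)
    simp
  have hstep : ∀ k : ℕ, 1 ≤ k →
      ψ k (μ k) + (f (μ k) + inner ℝ (g k) (μ k)) - C ^ 2 / σ * (2 * ((k : ℝ) + 1)⁻¹)
        ≤ ψ (k + 1) (μ (k + 1)) := by
    intro k hk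
    have hk' : (1 : ℝ) ≤ k := by exact_mod_cast hk
    have ha : 0 < (k : ℝ) + β := by linarith
    have hs := hstrong k hk (μ (k + 1)) (hK _)
    set d := μ (k + 1) - μ k with hd
    set a := (k : ℝ) + β with ha'
    have hs' := mul_le_mul_of_nonneg_left hs (by linarith : 0 ≤ a + 1)
    have e1 : inner ℝ (S k) (μ (k + 1)) = inner ℝ (S k) (μ k) + inner ℝ (S k) d := by
      rw [hd, inner_sub_right]; ring
    have e2 : inner ℝ (g k) (μ (k + 1)) = inner ℝ (g k) (μ k) + inner ℝ (g k) d := by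
      rw [hd, inner_sub_right]; ring
    -- `S k` is a sum of `k ≤ a` gradients, so rescaling the growth inequality from weight `a` to `a
    -- + 1` costs no more than one gradient.
    have hSd : a⁻¹ * inner ℝ (S k) d ≤ C * ‖d‖ := by
      rw [inv_mul_eq_div, div_le_iff₀ ha]
      calc inner ℝ (S k) d ≤ ‖S k‖ * ‖d‖ := real_inner_le_norm _ _
        _ ≤ (k * C) * ‖d‖ := mul_le_mul_of_nonneg_right (hSn k) (norm_nonneg _)
        _ ≤ (a * C) * ‖d‖ := by gcongr; linarith
        _ = C * ‖d‖ * a := by ring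
    have hgd : -(C * ‖d‖) ≤ inner ℝ (g k) d := by
      have h1 := (abs_le.1 (abs_real_inner_le_norm (g k) d)).1
      have h2 := mul_le_mul_of_nonneg_right (hg k) (norm_nonneg d)
      linarith
    have e3 : ψ (k + 1) (μ (k + 1)) = (a + 1) * f (μ (k + 1)) + inner ℝ (S k) (μ k)
        + inner ℝ (S k) d + inner ℝ (g k) (μ k) + inner ℝ (g k) d := by
      simp only [hψ]
      have : S (k + 1) = S k + g k := Finset.sum_range_succ _ _
      rw [this, inner_add_left, e1, e2]
      push_cast
      ring
    have e4 : ψ k (μ k) = a * f (μ k) + inner ℝ (S k) (μ k) := rfl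
    -- Completing the square in `‖d‖` gives the bound without the factor `2`, which is slack. These
    -- losses sum to a harmonic series, the source of the logarithm.
    have hquad : -(C ^ 2 / σ * (2 * ((k : ℝ) + 1)⁻¹)) ≤ (a + 1) * (σ * ‖d‖ ^ 2) - 2 * (C * ‖d‖) := by
      have hq : (0 : ℝ) < ((k : ℝ) + 1) * σ := by positivity
      have h1 : -(C ^ 2 / (((k : ℝ) + 1) * σ))
          ≤ ((k : ℝ) + 1) * σ * ‖d‖ ^ 2 - 2 * (C * ‖d‖) := by
        rw [neg_le_iff_add_nonneg, ← mul_nonneg_iff_of_pos_left hq, mul_add,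
          mul_div_cancel₀ _ hq.ne']
        nlinarith [sq_nonneg (((k : ℝ) + 1) * σ * ‖d‖ - C)]
      have h2 : C ^ 2 / (((k : ℝ) + 1) * σ) ≤ C ^ 2 / σ * (2 * ((k : ℝ) + 1)⁻¹) := by
        have : C ^ 2 / σ * (2 * ((k : ℝ) + 1)⁻¹) = 2 * (C ^ 2 / (((k : ℝ) + 1) * σ)) := by
          field_simp
        rw [this]
        have : 0 ≤ C ^ 2 / (((k : ℝ) + 1) * σ) := by positivity
        linarith
      have h3 : ((k : ℝ) + 1) * σ * ‖d‖ ^ 2 ≤ (a + 1) * (σ * ‖d‖ ^ 2) := by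
        rw [mul_assoc]
        gcongr
        linarith
      linarith
    rw [e3, e4]
    change (a + 1) * (f (μ k) + a⁻¹ * inner ℝ (S k) (μ k) + σ * ‖d‖ ^ 2)
      ≤ (a + 1) * (f (μ (k + 1)) + a⁻¹ * inner ℝ (S k) (μ (k + 1))) at hs'
    rw [e1] at hs'
    have e5 : (a + 1) * (a⁻¹ * inner ℝ (S k) d) = inner ℝ (S k) d + a⁻¹ * inner ℝ (S k) d := by
      field_simp
    nlinarith
  have hsum : ∀ t : ℕ, 1 ≤ t → ∑ k ∈ Finset.range t, (f (μ k) + inner ℝ (g k) (μ k))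
      ≤ ψ t (μ t) + (f (μ 0) + inner ℝ (g 0) (μ 0) - ψ 1 (μ 1))
        + C ^ 2 / σ * (2 * ∑ k ∈ Finset.range t, ((k : ℝ) + 1)⁻¹) := by
    intro t ht
    induction t, ht using Nat.le_induction with
    | base =>
      simp only [Finset.sum_range_one]
      have : 0 ≤ C ^ 2 / σ * (2 * (((0 : ℕ) : ℝ) + 1)⁻¹) := by positivity
      linarith
    | succ k hk ih =>
      have := hstep k hk
      rw [Finset.sum_range_succ, Finset.sum_range_succ]
      linarith
  have hharm : ∀ t : ℕ, ∑ k ∈ Finset.range t, ((k : ℝ) + 1)⁻¹ ≤ 1 + Real.log t := by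
    intro t
    have := harmonic_le_one_add_log t
    simpa [harmonic] using this
  refine ⟨β * f u + (f (μ 0) + inner ℝ (g 0) (μ 0) - ψ 1 (μ 1)) + C ^ 2 / σ * 2,
    C ^ 2 / σ * 2, fun t ht => ?_⟩
  have hat : 0 < (t : ℝ) + β := by
    have : (1 : ℝ) ≤ t := by exact_mod_cast ht
    linarith
  have h1 := hsum t ht
  have h2 : ψ t (μ t) ≤ ψ t u := by
    have := mul_le_mul_of_nonneg_left (hu t ht) hat.le
    rw [mul_add, mul_add, mul_inv_cancel_left₀ hat.ne', mul_inv_cancel_left₀ hat.ne'] at this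
    exact this
  have h3 : ψ t u = ∑ k ∈ Finset.range t, (f u + inner ℝ (g k) u) + β * f u := by
    simp only [hψ, hS, sum_inner, Finset.sum_add_distrib, Finset.sum_const, Finset.card_range,
      nsmul_eq_mul]
    ring
  have h4 : ∑ k ∈ Finset.range t, (f (μ k) - f u + inner ℝ (g k) (μ k - u))
      = ∑ k ∈ Finset.range t, (f (μ k) + inner ℝ (g k) (μ k))
        - ∑ k ∈ Finset.range t, (f u + inner ℝ (g k) u) := by
    rw [← Finset.sum_sub_distrib]
    refine Finset.sum_congr rfl fun k _ => ?_
    rw [inner_sub_right]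
    ring
  have h5 := mul_le_mul_of_nonneg_left (hharm t) (by positivity : 0 ≤ C ^ 2 / σ * 2)
  rw [h4]
  linarith

end DualAveraging

/-! ### Convergence of Bethe-RDA -/

theorem exists_pos_forall_le {α : Type*} [Finite α] (f : α → ℝ) (hf : ∀ a, 0 < f a) :
    ∃ ε > 0, ∀ a, ε ≤ f a := by
  cases isEmpty_or_nonempty α
  · exact ⟨1, one_pos, fun a => isEmptyElim a⟩
  · obtain ⟨a, ha⟩ := Finite.exists_min f
    exact ⟨f a, hf a, ha⟩

theorem innerPolytope_anti {ε ε' : ℝ} (h : ε ≤ ε') :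
    innerPolytope G X ε' ⊆ innerPolytope G X ε :=
  fun _ hm => ⟨hm.1, fun a => h.trans (hm.2 a)⟩

theorem continuous_inferenceObjective :
    Continuous fun p : MarginalVec G X × MarginalVec G X => inferenceObjective G X p.1 p.2 := by
  unfold inferenceObjective
  exact ((continuous_betheEntropy G X).comp continuous_snd).neg.sub
    (continuous_fst.inner continuous_snd)

theorem inferenceObjective_eq (θ : MarginalVec G X) :
    inferenceObjective G X θ = fun m => -betheEntropy G X m + -inner ℝ θ m :=
  funext fun _ => sub_eq_add_neg _ _

theorem pos_of_isMinOn_inferenceObjective [∀ i, Nonempty (X i)]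
    (hH : ConvexOn ℝ (marginalPolytope G X) (fun m => -betheEntropy G X m))
    {θ m : MarginalVec G X} (hm : m ∈ marginalPolytope G X)
    (hmin : IsMinOn (inferenceObjective G X θ) (marginalPolytope G X) m) (a : Stat G X) :
    0 < m a := by
  refine pos_of_isMinOn hH hm (fun m => -inner ℝ θ m)
    (fun c _ => ⟨-inner ℝ θ (c - m), fun s _ => ?_⟩) ?_ a
  · simp only [inner_add_right, inner_smul_right]
    linarith
  · rwa [inferenceObjective_eq] at hmin

/-- The minimizers for bounded parameters have marginals bounded away from `0`. -/
theorem exists_forall_mem_innerPolytope [∀ i, Nonempty (X i)]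
    (hH : ConvexOn ℝ (marginalPolytope G X) (fun m => -betheEntropy G X m)) (R : ℝ) :
    ∃ ε > 0, ∀ θ : MarginalVec G X, ‖θ‖ ≤ R → ∀ m ∈ marginalPolytope G X,
      IsMinOn (inferenceObjective G X θ) (marginalPolytope G X) m →
        m ∈ innerPolytope G X ε := by
  set S : Set (MarginalVec G X × MarginalVec G X) :=
    (Metric.closedBall 0 R ×ˢ marginalPolytope G X) ∩
      {p | ∀ ν ∈ marginalPolytope G X,
        inferenceObjective G X p.1 p.2 ≤ inferenceObjective G X p.1 ν} with hS
  -- The pairs of a bounded parameter and a minimizer for it form a closed set, so each coordinate,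
  -- being positive there, attains a positive minimum.
  have hcomp : IsCompact S := by
    refine ((isCompact_closedBall _ _).prod (isCompact_marginalPolytope G X)).inter_right ?_
    simp only [Set.ofPred_forall]
    refine isClosed_iInter fun ν => isClosed_iInter fun _ => ?_
    have hν : Continuous fun p : MarginalVec G X × MarginalVec G X =>
        inferenceObjective G X p.1 ν :=
      continuous_const.sub (continuous_fst.inner continuous_const)
    exact isClosed_le continuous_inferenceObjective hν
  have hcoord : ∀ a : Stat G X, ∃ ε : ℝ, 0 < ε ∧ ∀ p ∈ S, ε ≤ p.2 a := by
    intro a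
    rcases S.eq_empty_or_nonempty with he | hne
    · exact ⟨1, one_pos, by simp [he]⟩
    · obtain ⟨p, hp, hmin⟩ := hcomp.exists_isMinOn hne
        (f := fun p : MarginalVec G X × MarginalVec G X => p.2 a) (by fun_prop)
      exact ⟨p.2 a, pos_of_isMinOn_inferenceObjective hH hp.1.2 (isMinOn_iff.2 hp.2) a,
        fun q hq => isMinOn_iff.1 hmin q hq⟩
  choose η hη hηle using hcoord
  obtain ⟨ε, hε, hle⟩ := exists_pos_forall_le η hη
  refine ⟨ε, hε, fun θ hθ m hm hmin => ⟨hm, fun a => (hle a).trans (hηle a (θ, m) ?_)⟩⟩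
  exact ⟨⟨mem_closedBall_zero_iff.2 hθ, hm⟩, isMinOn_iff.1 hmin⟩

/-- Quadratic growth at a minimizer of `-H_B + ℓ`, with `ℓ` convex. -/
theorem quadratic_growth {ε σ : ℝ}
    (hσ : ∀ x ∈ innerPolytope G X ε, ∀ y ∈ innerPolytope G X ε,
      -betheEntropy G X ((1 / 2 : ℝ) • x + (1 / 2 : ℝ) • y)
        ≤ (1 / 2) * -betheEntropy G X x + (1 / 2) * -betheEntropy G X y
          - σ * ‖y - x‖ ^ 2)
    {ℓ : MarginalVec G X → ℝ} (hℓ : ConvexOn ℝ (marginalPolytope G X) ℓ)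
    {x y : MarginalVec G X} (hx : x ∈ innerPolytope G X ε) (hy : y ∈ innerPolytope G X ε)
    (hmin : IsMinOn (fun m => -betheEntropy G X m + ℓ m) (marginalPolytope G X) x) :
    -betheEntropy G X x + ℓ x + 2 * σ * ‖y - x‖ ^ 2 ≤ -betheEntropy G X y + ℓ y := by
  have h1 := hσ x hx y hy
  have h2 := hℓ.2 hx.1 hy.1 (by norm_num : (0 : ℝ) ≤ 1 / 2) (by norm_num : (0 : ℝ) ≤ 1 / 2)
    (by norm_num)
  have h3 := isMinOn_iff.1 hmin _ (convex_marginalPolytope hx.1 hy.1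
    (by norm_num : (0 : ℝ) ≤ 1 / 2) (by norm_num : (0 : ℝ) ≤ 1 / 2) (by norm_num))
  simp only [smul_eq_mul] at h2
  linarith

theorem convexOn_neg_inner (θ : MarginalVec G X) :
    ConvexOn ℝ (marginalPolytope G X) fun m => -inner ℝ θ m := by
  refine ⟨convex_marginalPolytope, fun x _ y _ a b _ _ _ => ?_⟩
  simp only [inner_add_right, inner_smul_right, smul_eq_mul]
  linarith

theorem augmentedObjective_eq (θ : MarginalVec G X) (L : MarginalVec G X → ℝ) :
    augmentedObjective G X θ L = fun m => -betheEntropy G X m + (-inner ℝ θ m + L m) := by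
  funext m
  rw [augmentedObjective]
  ring

theorem augmentedObjective_eq_inferenceObjective_add (θ m : MarginalVec G X)
    (L : MarginalVec G X → ℝ) :
    augmentedObjective G X θ L m = inferenceObjective G X θ m + L m := rfl

/-- Convexity of `L - ⟨θ, ·⟩` bounds its difference quotients by its increment over the whole
segment, as `pos_of_isMinOn` requires. -/
theorem pos_of_isMinOn_augmentedObjective [∀ i, Nonempty (X i)]
    (hH : ConvexOn ℝ (marginalPolytope G X) (fun m => -betheEntropy G X m))
    {L : MarginalVec G X → ℝ} (hL : ConvexOn ℝ (marginalPolytope G X) L)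
    {θ m : MarginalVec G X} (hm : m ∈ marginalPolytope G X)
    (hmin : IsMinOn (augmentedObjective G X θ L) (marginalPolytope G X) m) (a : Stat G X) :
    0 < m a := by
  rw [augmentedObjective_eq] at hmin
  refine pos_of_isMinOn hH hm _ (fun c hc =>
    ⟨(-inner ℝ θ c + L c) - (-inner ℝ θ m + L m), fun s hs => ?_⟩) hmin a
  have h := ((convexOn_neg_inner θ).add hL).2 hm hc (sub_nonneg.2 hs.2) hs.1.le (by ring)
  have e : (1 - s) • m + s • c = m + s • (c - m) := by module
  simp only [e, smul_eq_mul, Pi.add_apply] at h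
  linarith

variable [∀ i, Nonempty (X i)]

theorem betheRDA_average (θ : MarginalVec G X) (L : MarginalVec G X → ℝ) (β : ℝ) (t : ℕ) :
    (t : ℝ) • (betheRDA G X θ L β t).1
      = ∑ k ∈ Finset.range t, gradient L (betheRDA G X θ L β k).2 := by
  induction t with
  | zero => simp
  | succ t ih =>
    have ht : (t : ℝ) + 1 ≠ 0 := by positivity
    rw [Finset.sum_range_succ, ← ih, betheRDA]
    push_cast
    rw [smul_add, smul_smul, smul_smul, mul_div_cancel₀ _ ht, mul_one_div_cancel ht,
      add_sub_cancel_right, one_smul]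

/-- Unrolling the running average cancels `t` against the factor `t / (t + β)`, which puts the
iterates in the form of `dualAveraging_regret`. -/
theorem betheRDA_snd (θ : MarginalVec G X) (L : MarginalVec G X → ℝ) (β : ℝ) (t : ℕ) :
    (betheRDA G X θ L β t).2 = marginalOracle G X (θ - ((t : ℝ) + β)⁻¹ •
      ∑ k ∈ Finset.range t, gradient L (betheRDA G X θ L β k).2) := by
  rw [← betheRDA_average]
  cases t with
  | zero => simp [betheRDA]
  | succ t =>
    rw [smul_smul, inv_mul_eq_div]
    simp only [betheRDA]
    push_cast
    rfl

theorem inferenceObjective_sub_smul (θ s m : MarginalVec G X) (c : ℝ) :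
    inferenceObjective G X (θ - c • s) m = inferenceObjective G X θ m + c * inner ℝ s m := by
  simp only [inferenceObjective, inner_sub_left, real_inner_smul_left]
  ring

theorem marginalOracle_mem (θ : MarginalVec G X) :
    marginalOracle G X θ ∈ marginalPolytope G X :=
  (Classical.choose_spec (exists_isMinOn_inferenceObjective G X θ)).1

theorem isMinOn_marginalOracle (θ : MarginalVec G X) :
    IsMinOn (inferenceObjective G X θ) (marginalPolytope G X) (marginalOracle G X θ) :=
  (Classical.choose_spec (exists_isMinOn_inferenceObjective G X θ)).2

/-- Two minimizers have positive marginals, hence share an inner polytope, where quadratic growth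
makes them coincide. -/
theorem existsUnique_minimizer
    (hH : ConvexOn ℝ (marginalPolytope G X) (fun m => -betheEntropy G X m))
    {L : MarginalVec G X → ℝ} (hL : ConvexOn ℝ (marginalPolytope G X) L)
    (hLc : ContinuousOn L (marginalPolytope G X)) (θ : MarginalVec G X) :
    ∃ μ ∈ marginalPolytope G X,
      IsMinOn (augmentedObjective G X θ L) (marginalPolytope G X) μ ∧
      ∀ ν ∈ marginalPolytope G X,
        IsMinOn (augmentedObjective G X θ L) (marginalPolytope G X) ν → ν = μ := by
  have hcont : ContinuousOn (augmentedObjective G X θ L) (marginalPolytope G X) := by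
    rw [augmentedObjective_eq]
    exact (continuous_betheEntropy G X).neg.continuousOn.add
      (ContinuousOn.add (by fun_prop) hLc)
  obtain ⟨μ, hμ, hmin⟩ := (isCompact_marginalPolytope G X).exists_isMinOn
    (marginalPolytope_nonempty G X) hcont
  refine ⟨μ, hμ, hmin, fun ν hν hminν => ?_⟩
  obtain ⟨ε₁, hε₁, h₁⟩ := exists_pos_forall_le _
    (pos_of_isMinOn_augmentedObjective hH hL hμ hmin)
  obtain ⟨ε₂, hε₂, h₂⟩ := exists_pos_forall_le _
    (pos_of_isMinOn_augmentedObjective hH hL hν hminν)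
  obtain ⟨σ, hσ, hσle⟩ := exists_midpoint_strongly_convex hH (lt_min hε₁ hε₂)
  have hle := isMinOn_iff.1 hminν μ hμ
  rw [augmentedObjective_eq] at hmin hle
  have hq := quadratic_growth hσle ((convexOn_neg_inner θ).add hL)
    (innerPolytope_anti (min_le_left _ _) ⟨hμ, h₁⟩)
    (innerPolytope_anti (min_le_right _ _) ⟨hν, h₂⟩) hmin
  simp only [Pi.add_apply] at hq hle
  have h0 : ‖ν - μ‖ ^ 2 ≤ 0 := by
    by_contra hpos
    nlinarith [mul_pos hσ (not_le.1 hpos)]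
  exact sub_eq_zero.1 (norm_eq_zero.1 (pow_eq_zero_iff two_ne_zero |>.1
    (le_antisymm h0 (sq_nonneg _))))

/-- The primal averages of Bethe-RDA are `O(log t / t)`-suboptimal, and the objective grows
quadratically around the minimizer along them. -/
theorem primalAverage_bounds
    (hH : ConvexOn ℝ (marginalPolytope G X) (fun m => -betheEntropy G X m))
    {L : MarginalVec G X → ℝ} {U : Set (MarginalVec G X)}
    (hU : IsOpen U) (hMU : marginalPolytope G X ⊆ U)
    (hL : ConvexOn ℝ U L) (hL' : DifferentiableOn ℝ L U)
    (θ : MarginalVec G X) {β : ℝ} (hβ : 0 ≤ β) {μ : MarginalVec G X}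
    (hμ : μ ∈ marginalPolytope G X)
    (hmin : IsMinOn (augmentedObjective G X θ L) (marginalPolytope G X) μ) :
    ∃ σ A B, 0 < σ ∧ ∀ t : ℕ, 1 ≤ t →
      σ * ‖primalAverage G X θ L β t - μ‖ ^ 2
        ≤ augmentedObjective G X θ L (primalAverage G X θ L β t) - augmentedObjective G X θ L μ ∧
      augmentedObjective G X θ L (primalAverage G X θ L β t) - augmentedObjective G X θ L μ
        ≤ (A + B * Real.log t) / t := by
  have hLM : ConvexOn ℝ (marginalPolytope G X) L := hL.subset hMU convex_marginalPolytope
  obtain ⟨C, hC, hgrad⟩ := exists_norm_gradient_le hL hU hL' (isCompact_marginalPolytope G X) hMU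
  set x : ℕ → MarginalVec G X := fun k => (betheRDA G X θ L β k).2 with hx
  set g : ℕ → MarginalVec G X := fun k => gradient L (x k) with hg
  set θs : ℕ → MarginalVec G X := fun t =>
    θ - ((t : ℝ) + β)⁻¹ • ∑ k ∈ Finset.range t, g k with hθs
  have hxo : ∀ t, x t = marginalOracle G X (θs t) := betheRDA_snd θ L β
  have hxM : ∀ t, x t ∈ marginalPolytope G X := fun t => hxo t ▸ marginalOracle_mem _
  have hxmin : ∀ t, IsMinOn (inferenceObjective G X (θs t)) (marginalPolytope G X) (x t) :=
    fun t => hxo t ▸ isMinOn_marginalOracle _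
  have hgC : ∀ t, ‖g t‖ ≤ C := fun t => hgrad _ (hxM t)
  -- A bound uniform in `t`, so that one `ε₁` serves all iterates.
  have hθn : ∀ t, ‖θs t‖ ≤ ‖θ‖ + C := by
    intro t
    refine (norm_sub_le _ _).trans (add_le_add_right ?_ _)
    have h0 : 0 ≤ (t : ℝ) + β := by positivity
    rw [norm_smul, Real.norm_eq_abs, abs_of_nonneg (inv_nonneg.2 h0), inv_mul_eq_div]
    refine div_le_of_le_mul₀ h0 hC ?_
    calc ‖∑ k ∈ Finset.range t, g k‖ ≤ ∑ k ∈ Finset.range t, C :=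
          (norm_sum_le _ _).trans (Finset.sum_le_sum fun k _ => hgC k)
      _ = t * C := by simp
      _ ≤ C * ((t : ℝ) + β) := by nlinarith
  obtain ⟨ε₁, hε₁, h₁⟩ := exists_forall_mem_innerPolytope hH (‖θ‖ + C)
  obtain ⟨ε₂, hε₂, h₂⟩ := exists_pos_forall_le _
    (pos_of_isMinOn_augmentedObjective hH hLM hμ hmin)
  set ε := min ε₁ ε₂
  have hxK : ∀ t, x t ∈ innerPolytope G X ε := fun t =>
    innerPolytope_anti (min_le_left _ _) (h₁ _ (hθn t) _ (hxM t) (hxmin t))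
  have hμK : μ ∈ innerPolytope G X ε := innerPolytope_anti (min_le_right _ _) ⟨hμ, h₂⟩
  obtain ⟨σ, hσ, hσle⟩ := exists_midpoint_strongly_convex hH (lt_min hε₁ hε₂)
  obtain ⟨A, B, hAB⟩ := dualAveraging_regret (inferenceObjective G X θ)
    (K := innerPolytope G X ε) (μ := x) (g := g) (σ := 2 * σ) (u := μ) hβ (by positivity) hxK hgC
    (fun k _ y hy => by
      have hm := hxmin k
      have h := quadratic_growth hσle (convexOn_neg_inner (θs k)) (hxK k) hy
        (by rwa [inferenceObjective_eq] at hm)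
      simp only [← sub_eq_add_neg] at h
      change inferenceObjective G X (θs k) _ + _ ≤ inferenceObjective G X (θs k) _ at h
      rw [inferenceObjective_sub_smul, inferenceObjective_sub_smul] at h
      exact h)
    (fun k _ => by
      have h := isMinOn_iff.1 (hxmin k) μ hμ
      rw [inferenceObjective_sub_smul, inferenceObjective_sub_smul] at h
      exact h)
  refine ⟨2 * σ, A, B, by positivity, fun t ht => ?_⟩
  have ht0 : (0 : ℝ) < t := by exact_mod_cast ht
  have hw : ∑ k ∈ Finset.range t, (1 / (t : ℝ)) = 1 := by
    rw [Finset.sum_const, Finset.card_range, nsmul_eq_mul, mul_one_div_cancel ht0.ne']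
  have havg : primalAverage G X θ L β t = ∑ k ∈ Finset.range t, (1 / (t : ℝ)) • x k := by
    rw [primalAverage, Finset.smul_sum]
  have hK : primalAverage G X θ L β t ∈ innerPolytope G X ε := by
    rw [havg]
    exact (convex_innerPolytope ε).sum_mem (fun _ _ => by positivity) hw fun k _ => hxK k
  have hFconv : ConvexOn ℝ (marginalPolytope G X) (augmentedObjective G X θ L) := by
    rw [augmentedObjective_eq]
    exact hH.add ((convexOn_neg_inner θ).add hLM)
  constructor
  · have hmin' := hmin
    rw [augmentedObjective_eq] at hmin' ⊢
    have := quadratic_growth hσle ((convexOn_neg_inner θ).add hLM) hμK hK hmin'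
    simp only [Pi.add_apply] at this
    linarith
  · have hj := hFconv.map_sum_le (t := Finset.range t) (w := fun _ => 1 / (t : ℝ)) (p := x)
      (fun _ _ => by positivity) hw fun k _ => hxM k
    rw [← havg] at hj
    simp only [smul_eq_mul, ← Finset.mul_sum] at hj
    have hk : ∑ k ∈ Finset.range t, (augmentedObjective G X θ L (x k)
        - augmentedObjective G X θ L μ) ≤ A + B * Real.log t := by
      -- The gradient inequality bounds `L (x k) - L μ` by the linear regret term.
      refine le_trans (Finset.sum_le_sum fun k _ => ?_) (hAB t ht)
      have := inner_gradient_le_sub hL (hMU (hxM k)) (hMU hμ)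
        (hL'.differentiableAt (hU.mem_nhds (hMU (hxM k))))
      have e : inner ℝ (g k) (x k - μ) = -inner ℝ (gradient L (x k)) (μ - x k) := by
        rw [← inner_neg_right, neg_sub]
      rw [e, augmentedObjective_eq_inferenceObjective_add,
        augmentedObjective_eq_inferenceObjective_add]
      linarith
    rw [Finset.sum_sub_distrib, Finset.sum_const, Finset.card_range, nsmul_eq_mul] at hk
    rw [le_div_iff₀ ht0]
    have hj' := mul_le_mul_of_nonneg_right hj ht0.le
    have e2 : 1 / (t : ℝ) * (∑ k ∈ Finset.range t, augmentedObjective G X θ L (x k)) * t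
        = ∑ k ∈ Finset.range t, augmentedObjective G X θ L (x k) := by
      field_simp
    rw [e2] at hj'
    linarith

end Model

end BetheRDA

end

theorem mainTheorem2 {V : Type*} [Fintype V] [DecidableEq V]
    (G : SimpleGraph V) [DecidableRel G.Adj]
    (X : V → Type*) [∀ i, Fintype (X i)] [∀ i, DecidableEq (X i)] [∀ i, Nonempty (X i)]
    (hH : ConvexOn ℝ (BetheRDA.marginalPolytope G X) (fun m => -BetheRDA.betheEntropy G X m))
    (L : BetheRDA.MarginalVec G X → ℝ) (U : Set (BetheRDA.MarginalVec G X))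
    (hU : IsOpen U) (hMU : BetheRDA.marginalPolytope G X ⊆ U)
    (hL : ConvexOn ℝ U L) (hL' : DifferentiableOn ℝ L U)
    (θ : BetheRDA.MarginalVec G X) (β : ℝ) (hβ : 0 ≤ β) :
    ∃ μopt ∈ BetheRDA.marginalPolytope G X,
      IsMinOn (BetheRDA.augmentedObjective G X θ L) (BetheRDA.marginalPolytope G X) μopt ∧
      (∀ ν ∈ BetheRDA.marginalPolytope G X,
        IsMinOn (BetheRDA.augmentedObjective G X θ L) (BetheRDA.marginalPolytope G X) ν →
          ν = μopt) ∧
      Tendsto (BetheRDA.primalAverage G X θ L β) atTop (𝓝 μopt) ∧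
      (fun t : ℕ => BetheRDA.augmentedObjective G X θ L (BetheRDA.primalAverage G X θ L β t)
          - BetheRDA.augmentedObjective G X θ L μopt)
        =O[atTop] (fun t : ℕ => Real.log t / t) := by
  have hLM := hL.subset hMU BetheRDA.convex_marginalPolytope
  obtain ⟨μ, hμ, hmin, huniq⟩ := BetheRDA.existsUnique_minimizer hH hLM
    (hL'.continuousOn.mono hMU) θ
  obtain ⟨σ, A, B, hσ, hb⟩ := BetheRDA.primalAverage_bounds hH hU hMU hL hL' θ hβ hμ hmin
  have hO : (fun t : ℕ => BetheRDA.augmentedObjective G X θ L (BetheRDA.primalAverage G X θ L β t)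
      - BetheRDA.augmentedObjective G X θ L μ) =O[atTop] (fun t : ℕ => Real.log t / t) := by
    refine IsBigO.of_bound (|A| + |B|) ?_
    -- From `t = 3` on, `log t ≥ 1`, so `log t` absorbs the constant `A`.
    filter_upwards [eventually_ge_atTop 3] with t ht
    have ht' : (3 : ℝ) ≤ t := by exact_mod_cast ht
    have hlog : 1 ≤ Real.log t := by
      rw [Real.le_log_iff_exp_le (by linarith)]
      linarith [Real.exp_one_lt_d9]
    obtain ⟨h1, h2⟩ := hb t (by omega)
    have h0 : 0 ≤ BetheRDA.augmentedObjective G X θ L (BetheRDA.primalAverage G X θ L β t)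
        - BetheRDA.augmentedObjective G X θ L μ := le_trans (by positivity) h1
    rw [Real.norm_of_nonneg h0, Real.norm_of_nonneg (by positivity), ← mul_div_assoc]
    refine h2.trans (div_le_div_of_nonneg_right ?_ (by positivity))
    nlinarith [le_abs_self A, le_abs_self B, abs_nonneg A]
  refine ⟨μ, hμ, hmin, huniq, ?_, hO⟩
  have hlim : Tendsto (fun t : ℕ => Real.log t / t) atTop (𝓝 0) :=
    (Real.isLittleO_log_id_atTop.tendsto_div_nhds_zero).comp tendsto_natCast_atTop_atTop
  have hF := hO.trans_tendsto hlim
  rw [tendsto_iff_norm_sub_tendsto_zero]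
  have hsq : Tendsto (fun t : ℕ => ‖BetheRDA.primalAverage G X θ L β t - μ‖ ^ 2) atTop (𝓝 0) := by
    refine squeeze_zero' (Eventually.of_forall fun t => sq_nonneg _) ?_
      (by simpa using hF.const_mul σ⁻¹)
    filter_upwards [eventually_ge_atTop 1] with t ht
    rw [inv_mul_eq_div, le_div_iff₀ hσ, mul_comm]
    exact (hb t ht).1
  simpa using hsq.sqrt
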